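/- Let $\mathfrak g$ be a finite-dimensional simple Lie algebra over $\mathbb C$ all of whose roots have the same length (type $A_N$, $D_N$ or $E_N$), with Cartan subalgebra $\mathfrak h$ of dimension $N$ and invariant form $(\cdot\,|\,\cdot)$ normalized by $(\alpha\,|\,\alpha)=2$ for all roots $\alpha$. Let $M$ be a Coxeter element, $h$ its order (the Coxeter number) and $\eta=e^{2\pi i/h}$. Extend $M$ to an automorphism of $\mathfrak g$, and choose generators $A_\alpha\neq 0$ of the root spaces $\mathfrak g_\alpha$ that form an $M$-invariant set, so that $MA_\alpha=A_{M\alpha}$. Let $0<m_1\le\dots\le m_N<h$ be the exponents, and let $H_1,\dots,H_N$ be a basis of $\mathfrak h$ with $MH_i=\eta^{m_i}H_i$ and $(H_i\,|\,H_j)=h\,\delta_{i+j,N+1}$. Let $\widehat{\mathfrak g}=\mathfrak g[t,t^{-1}]\oplus\mathbb CK\oplus\mathbb Cd$ with $[Xt^n,Yt^m]=[X,Y]t^{n+m}+n\delta_{n,-m}(X|Y)K$, $[d,Xt^n]=nXt^n$, $K$ central; let $M$ act on it by $M(Xt^m)=MX\,(\eta^{-1}t)^m$, $MK=K$, $Md=d$,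 and let $\widehat{\mathfrak g}^M$ be the subalgebra of invariants. For $X\in\mathfrak g$ and $n\in\mathbb Z$ put $X_{(n)}=h^{-1}\sum_{k=1}^hM^k(Xt^n)$; write $H_{i,n}=(H_i)_{(n)}$ and $A_{\alpha,n}=(A_\alpha)_{(n)}$. Let $E_+$ be the set of pairs $(i,n)$ with $1\le i\le N$, $n\ge 0$; write $m=m_i+nh$, $a(m)=i$ and $a(-m)=N+1-i$ for such a pair. Consider any representation of $\widehat{\mathfrak g}^M$ on the Fock space $\mathbb C[y_m\mid m\in E_+]$ with $K\mapsto 1/h$, $H_{a(m),m}\mapsto\partial/\partial y_m$ and $H_{a(-m),-m}\mapsto m\,y_m$ for $m\in E_+$ (the principal realization of the level $1$ basic representation). Put $x_{\pm\alpha}(\zeta)=\sum_{n\in\mathbb Z}A_{\pm\alpha,n}\zeta^{-n}$ and $$\Gamma^{\pm\alpha}(\zeta)=\exp\Big(\pm\sum_{m\in E_+}\alpha(H_{a(m)})\,y_m\,\zeta^m\Big)\exp\Big(\mp\sum_{m\in E_+}\alpha(H_{a(-m)})\,\partial_{y_m}\,\zeta^{-m}/m\Big).$$ Then for every root $\alpha$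 there is exactly one number $a$ (the Kac–Wakimoto coefficient of $\alpha$) with $$\frac{h}{(A_\alpha\,|\,A_{-\alpha})}\;x_\alpha(\zeta)\otimes x_{-\alpha}(\zeta)=a\;\Gamma^\alpha(\zeta)\otimes\Gamma^{-\alpha}(\zeta),$$ and it is $$a=h^{-1}\prod_{k=1}^{h-1}\big(1-\eta^k\big)^{(\alpha\,|\,M^k\alpha)}.$$ In particular, if $\alpha_1,\dots,\alpha_N$ represent the $M$-orbits of roots, the coefficients are $a_i=h^{-1}\prod_{k=1}^{h-1}(1-\eta^k)^{(\alpha_i|M^k\alpha_i)}$. -/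

import Mathlib

open scoped TensorProduct

noncomputable section

namespace KacWakimoto

/-! ### The affine Kac--Moody algebra -/

section Affine

variable {g : Type*} [LieRing g] [LieAlgebra ℂ g]

/-- The loop algebra `g[t, t⁻¹]`, as finitely supported families of coefficients. -/
abbrev Loop (g : Type*) [LieRing g] [LieAlgebra ℂ g] : Type _ := ℤ →₀ g

/-- The element `X tⁿ` of the loop algebra. -/
def tpow (X : g) (n : ℤ) : Loop g := Finsupp.single n X

theorem loop_induction {p : Loop g → Prop} (h0 : p 0) (h1 : ∀ X n, p (tpow X n))
    (h2 : ∀ x y, p x → p y → p (x + y)) (x : Loop g) : p x :=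
  Finsupp.induction_linear x h0 (fun x y => h2 x y) (fun n X => h1 X n)

/-- The bracket of the loop algebra, `[X tⁿ, Y tᵐ] = [X, Y] tⁿ⁺ᵐ`, as a bilinear map. -/
def loopLie : Loop g →ₗ[ℂ] Loop g →ₗ[ℂ] Loop g :=
  Finsupp.lsum ℂ fun n : ℤ => LinearMap.flip (Finsupp.lsum ℂ fun m : ℤ =>
    ((LieModule.toEnd ℂ g g : g →ₗ[ℂ] Module.End ℂ g).flip).compr₂ (Finsupp.lsingle (n + m)))

@[simp] theorem loopLie_tpow (X Y : g) (n m : ℤ) :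
    loopLie (tpow X n) (tpow Y m) = tpow ⁅X, Y⁆ (n + m) := by
  simp [loopLie, tpow]

theorem loopLie_skew (x y : Loop g) : loopLie x y = -loopLie y x := by
  induction x using loop_induction with
  | h0 => simp
  | h2 x x' hx hx' => simp only [map_add, LinearMap.add_apply, hx, hx']; abel
  | h1 X n =>
    induction y using loop_induction with
    | h0 => simp
    | h2 x x' hx hx' => simp only [map_add, LinearMap.add_apply, hx, hx']; abel
    | h1 Y m =>
      rw [loopLie_tpow, loopLie_tpow, ← lie_skew, add_comm n m]
      simp only [tpow, Finsupp.single_neg]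

theorem loopLie_jacobi (x y z : Loop g) :
    loopLie x (loopLie y z) = loopLie (loopLie x y) z + loopLie y (loopLie x z) := by
  induction x using loop_induction with
  | h0 => simp
  | h2 x x' hx hx' => simp only [map_add, LinearMap.add_apply, hx, hx']; abel
  | h1 X n =>
    induction y using loop_induction with
    | h0 => simp
    | h2 x x' hx hx' => simp only [map_add, LinearMap.add_apply, hx, hx']; abel
    | h1 Y m =>
      induction z using loop_induction with
      | h0 => simp
      | h2 x x' hx hx' => simp only [map_add, hx, hx']; abel
      | h1 Z l =>
        simp only [loopLie_tpow]
        rw [leibniz_lie X Y Z, add_assoc n m l, add_left_comm m n l]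
        simp [tpow]

/-- The derivation `t d/dt` of the loop algebra, `X tⁿ ↦ n X tⁿ`. -/
def loopDeg : Loop g →ₗ[ℂ] Loop g :=
  Finsupp.lsum ℂ fun n : ℤ => (n : ℂ) • Finsupp.lsingle n

@[simp] theorem loopDeg_tpow (X : g) (n : ℤ) : loopDeg (tpow X n) = (n : ℂ) • tpow X n := by
  simp [loopDeg, tpow]

theorem loopDeg_lie (x y : Loop g) :
    loopDeg (loopLie x y) = loopLie (loopDeg x) y + loopLie x (loopDeg y) := by
  induction x using loop_induction with
  | h0 => simp
  | h2 x x' hx hx' => simp only [map_add, LinearMap.add_apply, hx, hx']; abel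
  | h1 X n =>
    induction y using loop_induction with
    | h0 => simp
    | h2 x x' hx hx' => simp only [map_add, hx, hx']; abel
    | h1 Y m => simp [add_smul]

/-- An adjoint-invariant symmetric bilinear form `(· | ·)` on `g`. -/
structure InvForm (g : Type*) [LieRing g] [LieAlgebra ℂ g] where
  form : LinearMap.BilinForm ℂ g
  symm : form.IsSymm
  inv : ∀ x y z : g, form ⁅x, y⁆ z = -form y ⁅x, z⁆

/-- The 2-cocycle `(X tⁿ, Y tᵐ) ↦ n δ_{n,-m} (X | Y)` on the loop algebra. -/
def cocycle (B : InvForm g) : Loop g →ₗ[ℂ] Loop g →ₗ[ℂ] ℂ :=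
  Finsupp.lsum ℂ fun n : ℤ => LinearMap.flip (Finsupp.lsum ℂ fun m : ℤ =>
    if n = -m then (n : ℂ) • B.form.flip else 0)

theorem cocycle_tpow (B : InvForm g) (X Y : g) (n m : ℤ) :
    cocycle B (tpow X n) (tpow Y m) = if n = -m then (n : ℂ) * B.form X Y else 0 := by
  by_cases h : n = -m <;> simp [cocycle, tpow, h]

theorem cocycle_skew (B : InvForm g) (x y : Loop g) : cocycle B x y = -cocycle B y x := by
  induction x using loop_induction with
  | h0 => simp
  | h2 x x' hx hx' => simp only [map_add, LinearMap.add_apply, hx, hx']; ring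
  | h1 X n =>
    induction y using loop_induction with
    | h0 => simp
    | h2 x x' hx hx' => simp only [map_add, LinearMap.add_apply, hx, hx']; ring
    | h1 Y m =>
      rw [cocycle_tpow, cocycle_tpow, show B.form Y X = B.form X Y from B.symm.eq Y X]
      by_cases h : n = -m
      · subst h; simp
      · rw [if_neg h, if_neg (by omega)]; simp

theorem cocycle_lie (B : InvForm g) (x y z : Loop g) :
    cocycle B x (loopLie y z) = cocycle B (loopLie x y) z + cocycle B y (loopLie x z) := by
  induction x using loop_induction with
  | h0 => simp
  | h2 x x' hx hx' => simp only [map_add, LinearMap.add_apply, hx, hx']; ring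
  | h1 X n =>
    induction y using loop_induction with
    | h0 => simp
    | h2 x x' hx hx' => simp only [map_add, LinearMap.add_apply, hx, hx']; ring
    | h1 Y m =>
      induction z using loop_induction with
      | h0 => simp
      | h2 x x' hx hx' => simp only [map_add, hx, hx']; ring
      | h1 Z l =>
        simp only [loopLie_tpow, cocycle_tpow]
        by_cases h : n = -(m + l)
        · rw [if_pos h, if_pos (by omega), if_pos (by omega)]
          have e1 : B.form X ⁅Y, Z⁆ = B.form ⁅X, Y⁆ Z := by
            have := B.inv Y X Z
            rw [← lie_skew X Y, map_neg, LinearMap.neg_apply, this, neg_neg]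
          have e2 : B.form Y ⁅X, Z⁆ = -B.form ⁅X, Y⁆ Z := by
            have := B.inv X Y Z
            rw [this]; simp
          rw [e1, e2]; push_cast; ring
        · rw [if_neg h, if_neg (by omega), if_neg (by omega)]; simp

theorem cocycle_deg (B : InvForm g) (x y : Loop g) :
    cocycle B (loopDeg x) y = -cocycle B x (loopDeg y) := by
  induction x using loop_induction with
  | h0 => simp
  | h2 x x' hx hx' => simp only [map_add, LinearMap.add_apply, hx, hx']; ring
  | h1 X n =>
    induction y using loop_induction with
    | h0 => simp
    | h2 x x' hx hx' => simp only [map_add, hx, hx']; ring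
    | h1 Y m =>
      simp only [loopDeg_tpow, map_smul, LinearMap.smul_apply, smul_eq_mul, cocycle_tpow]
      by_cases h : n = -m
      · subst h; simp
      · simp [h]

/-- The affine Lie algebra `ĝ = g[t, t⁻¹] ⊕ ℂ K ⊕ ℂ d`; the element `(x, a, b)` is
`x + a K + b d`. -/
def Affine (_B : InvForm g) : Type _ := Loop g × ℂ × ℂ

instance (B : InvForm g) : AddCommGroup (Affine B) := inferInstanceAs (AddCommGroup (_ × _ × _))
instance (B : InvForm g) : Module ℂ (Affine B) := inferInstanceAs (Module ℂ (Loop g × ℂ × ℂ))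

namespace Affine

variable (B : InvForm g)

/-- The element `x + a K + b d`. -/
def mk (x : Loop g) (a b : ℂ) : Affine B := (x, a, b)
/-- The component in `g[t, t⁻¹]`. -/
def loop {B : InvForm g} (x : Affine B) : Loop g := x.1
/-- The coefficient of `K`. -/
def cK {B : InvForm g} (x : Affine B) : ℂ := x.2.1
/-- The coefficient of `d`. -/
def cd {B : InvForm g} (x : Affine B) : ℂ := x.2.2

variable {B}

@[ext] theorem ext {x y : Affine B} (h1 : x.loop = y.loop) (h2 : x.cK = y.cK)
    (h3 : x.cd = y.cd) : x = y := Prod.ext h1 (Prod.ext h2 h3)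

@[simp] theorem loop_mk (x : Loop g) (a b : ℂ) : (mk B x a b).loop = x := rfl
@[simp] theorem cK_mk (x : Loop g) (a b : ℂ) : (mk B x a b).cK = a := rfl
@[simp] theorem cd_mk (x : Loop g) (a b : ℂ) : (mk B x a b).cd = b := rfl
@[simp] theorem loop_add (x y : Affine B) : (x + y).loop = x.loop + y.loop := rfl
@[simp] theorem cK_add (x y : Affine B) : (x + y).cK = x.cK + y.cK := rfl
@[simp] theorem cd_add (x y : Affine B) : (x + y).cd = x.cd + y.cd := rfl
@[simp] theorem loop_smul (c : ℂ) (x : Affine B) : (c • x).loop = c • x.loop := rfl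
@[simp] theorem cK_smul (c : ℂ) (x : Affine B) : (c • x).cK = c * x.cK := rfl
@[simp] theorem cd_smul (c : ℂ) (x : Affine B) : (c • x).cd = c * x.cd := rfl
@[simp] theorem loop_zero : (0 : Affine B).loop = 0 := rfl
@[simp] theorem cK_zero : (0 : Affine B).cK = 0 := rfl
@[simp] theorem cd_zero : (0 : Affine B).cd = 0 := rfl

/-- The Lie bracket of `ĝ`: `[X tⁿ, Y tᵐ] = [X, Y] tⁿ⁺ᵐ + n δ_{n,-m} (X | Y) K`,
`[d, X tⁿ] = n X tⁿ`, `K` central. -/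
instance : Bracket (Affine B) (Affine B) where
  bracket x y := mk B (loopLie x.loop y.loop + x.cd • loopDeg y.loop - y.cd • loopDeg x.loop)
    (cocycle B x.loop y.loop) 0

@[simp] theorem loop_lie (x y : Affine B) :
    ⁅x, y⁆.loop = loopLie x.loop y.loop + x.cd • loopDeg y.loop - y.cd • loopDeg x.loop := rfl
@[simp] theorem cK_lie (x y : Affine B) : ⁅x, y⁆.cK = cocycle B x.loop y.loop := rfl
@[simp] theorem cd_lie (x y : Affine B) : ⁅x, y⁆.cd = 0 := rfl

instance : LieRing (Affine B) where
  add_lie x y z := by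
    ext1
    · simp only [loop_lie, loop_add, cd_add, LinearMap.add_apply, add_smul, map_add, smul_add]
      abel
    · simp
    · simp
  lie_add x y z := by
    ext1
    · simp only [loop_lie, loop_add, cd_add, add_smul, map_add, smul_add]; abel
    · simp
    · simp
  lie_self x := by
    ext1
    · have h := loopLie_skew x.loop x.loop
      have h2 : (2 : ℂ) • loopLie x.loop x.loop = 0 := by
        rw [two_smul]; nth_rewrite 1 [h]; simp
      simpa using h2
    · have := cocycle_skew B x.loop x.loop
      simp only [cK_lie, cK_zero]
      linear_combination this / 2
    · simp
  leibniz_lie x y z := by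
    ext1
    · simp only [loop_lie, loop_add, cd_lie, map_add, map_sub, LinearMap.add_apply,
        LinearMap.sub_apply, LinearMap.smul_apply, map_smul, loopDeg_lie, smul_add, smul_sub,
        zero_smul, loopLie_jacobi x.loop y.loop z.loop]
      rw [smul_comm x.cd y.cd, smul_comm x.cd z.cd, smul_comm y.cd z.cd,
        loopLie_skew (loopDeg x.loop) y.loop]
      simp only [smul_neg]
      abel
    · simp only [cK_lie, loop_lie, cK_add, map_add, map_sub, LinearMap.add_apply,
        LinearMap.sub_apply, LinearMap.smul_apply, map_smul, smul_eq_mul]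
      rw [cocycle_lie, cocycle_deg B x.loop z.loop, cocycle_deg B y.loop z.loop,
        cocycle_skew B y.loop (loopDeg x.loop), cocycle_deg B x.loop y.loop]
      ring
    · simp

instance : LieAlgebra ℂ (Affine B) where
  lie_smul c x y := by
    ext1
    · simp only [loop_lie, loop_smul, cd_smul, map_smul, smul_add, smul_sub,
        smul_comm c x.cd, mul_smul]
    · simp
    · simp

/-- The element `X tⁿ` of `ĝ`. -/
def t (B : InvForm g) (X : g) (n : ℤ) : Affine B := mk B (tpow X n) 0 0
/-- The central element `K` of `ĝ`. -/
def K (B : InvForm g) : Affine B := mk B 0 1 0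
/-- The element `d` of `ĝ`. -/
def d (B : InvForm g) : Affine B := mk B 0 0 1

end Affine

theorem Affine.t_lie (B : InvForm g) (X Y : g) (n m : ℤ) :
    ⁅Affine.t B X n, Affine.t B Y m⁆ =
      Affine.t B ⁅X, Y⁆ (n + m) + (if n = -m then (n : ℂ) * B.form X Y else 0) • Affine.K B := by
  rw [Affine.t, Affine.t]
  ext1
  · simp only [Affine.loop_lie, Affine.loop_mk, Affine.cd_mk, loopLie_tpow, Affine.loop_add,
      Affine.loop_smul, Affine.t, Affine.K]
    simp
  · simp only [Affine.cK_lie, Affine.loop_mk, Affine.cK_add, Affine.cK_smul, Affine.t, Affine.K,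
      cocycle_tpow]
    simp
  · simp only [Affine.cd_lie, Affine.cd_add, Affine.cd_smul, Affine.t, Affine.K]
    simp

theorem Affine.d_lie (B : InvForm g) (X : g) (n : ℤ) :
    ⁅Affine.d B, Affine.t B X n⁆ = (n : ℂ) • Affine.t B X n := by
  ext1 <;> simp [Affine.t, Affine.d]

theorem Affine.K_lie (B : InvForm g) (x : Affine B) : ⁅Affine.K B, x⁆ = 0 := by
  ext1 <;> simp [Affine.K]

/-- The linear map `X tᵐ ↦ σ X (q t)ᵐ` of the loop algebra. -/
def twistLoop (σ : g ≃ₗ⁅ℂ⁆ g) (q : ℂ) : Module.End ℂ (Loop g) :=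
  Finsupp.lsum ℂ (fun m : ℤ => (q ^ m) • (Finsupp.lsingle m ∘ₗ (σ : g →ₗ[ℂ] g)))

/-- The linear map `X tᵐ ↦ σ X (q t)ᵐ`, `K ↦ K`, `d ↦ d` of `ĝ`. -/
def twist (B : InvForm g) (σ : g ≃ₗ⁅ℂ⁆ g) (q : ℂ) : Module.End ℂ (Affine B) where
  toFun x := Affine.mk B (twistLoop σ q x.loop) x.cK x.cd
  map_add' x y := by ext1 <;> simp
  map_smul' c x := by ext1 <;> simp

@[simp] theorem twist_loop (B : InvForm g) (σ : g ≃ₗ⁅ℂ⁆ g) (q : ℂ) (x : Affine B) :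
    (twist B σ q x).loop = twistLoop σ q x.loop := rfl
@[simp] theorem twist_cK (B : InvForm g) (σ : g ≃ₗ⁅ℂ⁆ g) (q : ℂ) (x : Affine B) :
    (twist B σ q x).cK = x.cK := rfl
@[simp] theorem twist_cd (B : InvForm g) (σ : g ≃ₗ⁅ℂ⁆ g) (q : ℂ) (x : Affine B) :
    (twist B σ q x).cd = x.cd := rfl

@[simp] theorem twistLoop_tpow (σ : g ≃ₗ⁅ℂ⁆ g) (q : ℂ) (X : g) (n : ℤ) :
    twistLoop σ q (tpow X n) = q ^ n • tpow (σ X) n := by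
  simp [twistLoop, tpow]

/-- On a simple Lie algebra invariant forms are preserved by automorphisms. -/
theorem InvForm.map_equiv [FiniteDimensional ℂ g] [LieAlgebra.IsSimple ℂ g] (B : InvForm g)
    (σ : g ≃ₗ⁅ℂ⁆ g) (x y : g) : B.form (σ x) (σ y) = B.form x y := by
  have hnd := LieAlgebra.IsKilling.killingForm_nondegenerate ℂ g
  let φ : Module.End ℂ g :=
    ((killingForm ℂ g).toDual hnd).symm.toLinearMap ∘ₗ B.form
  have hφ (x y : g) : killingForm ℂ g (φ x) y = B.form x y := by
    have : (killingForm ℂ g).toDual hnd (φ x) = B.form x := by simp [φ]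
    rw [← this, LinearMap.BilinForm.toDual_def]
  have : Nontrivial g := by
    by_contra hc
    rw [not_nontrivial_iff_subsingleton] at hc
    exact LieAlgebra.IsSimple.non_abelian ℂ (L := g) ⟨fun _ _ => Subsingleton.elim _ _⟩
  obtain ⟨c, hc⟩ := Module.End.exists_eigenvalue φ
  obtain ⟨v, hv⟩ := hc.exists_hasEigenvector
  have hinv := LieModule.traceForm_lieInvariant ℂ g g
  let I : LieIdeal ℂ g :=
    { carrier := {x | ∀ y, B.form x y = c * killingForm ℂ g x y}
      add_mem' := by
        intro a b ha hb y
        simp only [Set.mem_ofPred_eq] at ha hb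
        simp only [map_add, LinearMap.add_apply, ha, hb]; ring
      zero_mem' := by intro y; simp
      smul_mem' := by
        intro r a ha y
        simp only [Set.mem_ofPred_eq] at ha
        simp only [map_smul, LinearMap.smul_apply, ha, smul_eq_mul]; ring
      lie_mem := by
        intro z a ha y
        change ∀ y, B.form a y = c * killingForm ℂ g a y at ha
        rw [B.inv, ha]
        have := hinv z a y
        change killingForm ℂ g ⁅z, a⁆ y = -killingForm ℂ g a ⁅z, y⁆ at this
        rw [this]; ring }
  have hvI : v ∈ I := by
    intro y
    rw [← hφ, hv.apply_eq_smul]; simp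
  have hI : I = ⊤ := by
    rcases LieAlgebra.IsSimple.eq_bot_or_eq_top I with h | h
    · exact absurd (by rw [h] at hvI; simpa using hvI) hv.2
    · exact h
  have key (x y : g) : B.form x y = c * killingForm ℂ g x y := by
    have : x ∈ I := by rw [hI]; trivial
    exact this y
  rw [key, key, LieAlgebra.killingForm_of_equiv_apply]

theorem twistLoop_lie (σ : g ≃ₗ⁅ℂ⁆ g) {q : ℂ} (hq : q ≠ 0) (x y : Loop g) :
    twistLoop σ q (loopLie x y) = loopLie (twistLoop σ q x) (twistLoop σ q y) := by
  induction x using loop_induction with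
  | h0 => simp
  | h2 x x' hx hx' => simp only [map_add, LinearMap.add_apply, hx, hx']
  | h1 X n =>
    induction y using loop_induction with
    | h0 => simp
    | h2 x x' hx hx' => simp only [map_add, hx, hx']
    | h1 Y m =>
      simp only [loopLie_tpow, twistLoop_tpow, map_smul, LinearMap.smul_apply, smul_smul]
      rw [LieEquiv.map_lie, zpow_add₀ hq, mul_comm]

theorem twistLoop_deg (σ : g ≃ₗ⁅ℂ⁆ g) (q : ℂ) (x : Loop g) :
    twistLoop σ q (loopDeg x) = loopDeg (twistLoop σ q x) := by
  induction x using loop_induction with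
  | h0 => simp
  | h2 x x' hx hx' => simp only [map_add, hx, hx']
  | h1 X n =>
    simp only [loopDeg_tpow, twistLoop_tpow, map_smul, smul_smul, mul_comm]

theorem twistLoop_cocycle [FiniteDimensional ℂ g] [LieAlgebra.IsSimple ℂ g] (B : InvForm g)
    (σ : g ≃ₗ⁅ℂ⁆ g) {q : ℂ} (hq : q ≠ 0) (x y : Loop g) :
    cocycle B (twistLoop σ q x) (twistLoop σ q y) = cocycle B x y := by
  induction x using loop_induction with
  | h0 => simp
  | h2 x x' hx hx' => simp only [map_add, LinearMap.add_apply, hx, hx']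
  | h1 X n =>
    induction y using loop_induction with
    | h0 => simp
    | h2 x x' hx hx' => simp only [map_add, hx, hx']
    | h1 Y m =>
      simp only [twistLoop_tpow, map_smul, LinearMap.smul_apply, smul_eq_mul, cocycle_tpow,
        B.map_equiv]
      by_cases h : n = -m
      · subst h
        rw [if_pos rfl, ← mul_assoc, ← zpow_add₀ hq]; simp
      · simp [h]

theorem twist_lie [FiniteDimensional ℂ g] [LieAlgebra.IsSimple ℂ g] (B : InvForm g)
    (σ : g ≃ₗ⁅ℂ⁆ g) {q : ℂ} (hq : q ≠ 0) (x y : Affine B) :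
    twist B σ q ⁅x, y⁆ = ⁅twist B σ q x, twist B σ q y⁆ := by
  ext1
  · simp only [twist_loop, Affine.loop_lie, map_add, map_sub, map_smul, twistLoop_lie σ hq,
      twistLoop_deg, twist_cd]
  · simp only [twist_cK, Affine.cK_lie, twist_loop, twistLoop_cocycle B σ hq]
  · simp

theorem twist_pow_tpow (B : InvForm g) (σ : g ≃ₗ⁅ℂ⁆ g) (q : ℂ) (X : g) (n : ℤ) (k : ℕ) :
    (twist B σ q ^ k) (Affine.t B X n) =
      (q ^ n) ^ k • Affine.t B (((σ : g →ₗ[ℂ] g) ^ k) X) n := by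
  induction k with
  | zero => simp
  | succ k ih =>
    rw [pow_succ', Module.End.mul_apply, ih, map_smul, pow_succ' (σ : g →ₗ[ℂ] g),
      Module.End.mul_apply, pow_succ (q ^ n), mul_smul]
    congr 1
    ext1 <;> simp [Affine.t]

end Affine

/-! ### Coxeter elements and the data of the principal realization -/

/-- A Coxeter element of a root system: the product, in some order, of the reflections in the
simple roots of some base. -/
def IsCoxeterElement {ι R M N : Type*} [CommRing R] [AddCommGroup M] [Module R M]
    [AddCommGroup N] [Module R N] (P : RootPairing ι R M N) (c : M ≃ₗ[R] M) : Prop :=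
  ∃ (b : P.Base) (l : List ι), l.Nodup ∧ (∀ i, i ∈ l ↔ i ∈ b.support) ∧
    c = (l.map P.reflection).prod

/-- The complex number `e^{2πi/n}`. -/
def rootOfUnity (n : ℕ) : ℂ := Complex.exp (2 * Real.pi * Complex.I / n)

open Module (Dual)

section Data

variable {g : Type*} [LieRing g] [LieAlgebra ℂ g] [FiniteDimensional ℂ g]
  [LieAlgebra.IsSimple ℂ g]

/-- The linear functional on the Cartan subalgebra `H` given by a root. -/
def rootFun {H : LieSubalgebra ℂ g} [H.IsCartanSubalgebra] (α : H.root) : Dual ℂ H :=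
  (LieAlgebra.IsKilling.rootSystem H).root α

/-- The opposite `-α` of a root `α`. -/
def negRoot {H : LieSubalgebra ℂ g} [H.IsCartanSubalgebra] (α : H.root) : H.root :=
  ⟨-α.1, by
    have h := LieSubalgebra.isNonZero_coe_root α
    simpa using h⟩

/-- The data entering the principal realization of the affine algebra of a simple Lie algebra `g`
with Cartan subalgebra `H`, all of whose roots have the same length (type `A`, `D` or `E`). -/
structure PrincipalData (H : LieSubalgebra ℂ g) [H.IsCartanSubalgebra] where
  /-- The adjoint-invariant form `(· | ·)` on `g`. -/
  B : InvForm g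
  /-- Normalization `(α | α) = 2` for all roots: `t` is the element of `H` that corresponds to `α`
  under the form. -/
  normalized : ∀ α : H.root, ∃ t : H, (∀ x : H, B.form t x = rootFun α x) ∧ rootFun α t = 2
  /-- The Coxeter element `M`, acting on the dual of `H`. -/
  M : Dual ℂ H ≃ₗ[ℂ] Dual ℂ H
  isCoxeter : IsCoxeterElement (LieAlgebra.IsKilling.rootSystem H) M
  /-- The extension of `M` to an automorphism of `g`. -/
  σ : g ≃ₗ⁅ℂ⁆ g
  /-- `σ` preserves `H`, and its restriction to `H` induces `M` on the dual of `H`. -/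
  σ_cartan : ∀ x : H, ∃ y : H, (y : g) = σ x ∧ ∀ l : Dual ℂ H, M l y = l x
  /-- The generators `A_α` of the root spaces. -/
  A : H.root → g
  A_mem : ∀ α, A α ∈ LieAlgebra.rootSpace H α.1
  A_ne_zero : ∀ α, A α ≠ 0
  /-- The set of the `A_α` is invariant: `M A_α = A_{Mα}`. -/
  σ_A : ∀ α, ∃ β, rootFun β = M (rootFun α) ∧ σ (A α) = A β
  /-- The exponents `m_1 ≤ … ≤ m_N`, indexed from `0`. -/
  m : Fin (Module.finrank ℂ H) → ℕ
  m_mono : Monotone m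
  m_pos : ∀ i, 0 < m i
  m_lt : ∀ i, m i < orderOf M
  /-- The eigenbasis `H_1, …, H_N` of `H`, indexed from `0`. -/
  e : Module.Basis (Fin (Module.finrank ℂ H)) ℂ H
  σ_e : ∀ i, σ (e i) = rootOfUnity (orderOf M) ^ m i • (e i : g)
  /-- `(H_i | H_j) = h δ_{i+j,N+1}` for indices starting from `1`. -/
  form_e : ∀ i j, B.form (e i) (e j) = if j = Fin.rev i then (orderOf M : ℂ) else 0

namespace PrincipalData

variable {H : LieSubalgebra ℂ g} [H.IsCartanSubalgebra] (D : PrincipalData H)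

/-- The Coxeter number `h`, the order of the Coxeter element. -/
def h : ℕ := orderOf D.M

/-- `η = e^{2πi/h}`. -/
def η : ℂ := rootOfUnity D.h

theorem η_ne_zero : D.η ≠ 0 := Complex.exp_ne_zero _

theorem η_pow_h : D.η ^ D.h = 1 := by
  rw [η, rootOfUnity, ← Complex.exp_nat_mul]
  by_cases hh : (D.h : ℂ) = 0
  · simp [hh]
  · rw [mul_div_cancel₀ _ hh, Complex.exp_two_pi_mul_I]

/-- The identification of `H` with its dual given by the form. -/
def flat : H →ₗ[ℂ] Dual ℂ H := D.B.form.compl₁₂ H.toSubmodule.subtype H.toSubmodule.subtype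

theorem flat_apply (x y : H) : D.flat x y = D.B.form x y := rfl

theorem flat_bijective : Function.Bijective D.flat := by
  have hs : Function.Surjective D.flat := by
    rw [← LinearMap.range_eq_top, eq_top_iff,
      ← RootPairing.IsRootSystem.span_root_eq_top (P := LieAlgebra.IsKilling.rootSystem H),
      Submodule.span_le]
    rintro _ ⟨α, rfl⟩
    obtain ⟨t, ht, -⟩ := D.normalized α
    exact ⟨t, LinearMap.ext ht⟩
  exact ⟨(LinearMap.injective_iff_surjective_of_finrank_eq_finrank
    (Subspace.dual_finrank_eq (K := ℂ) (V := H)).symm).mpr hs, hs⟩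

/-- The bilinear form `(· | ·)` on the dual of `H`, transported from `H`. -/
def dualForm (l l' : Dual ℂ H) : ℂ :=
  let s := (LinearEquiv.ofBijective D.flat D.flat_bijective).symm
  D.B.form (s l) (s l')

/-- The lift of `M` to `ĝ`: `X tᵐ ↦ M X (η⁻¹ t)ᵐ`, `K ↦ K`, `d ↦ d`. -/
def affM : Module.End ℂ (Affine D.B) := twist D.B D.σ D.η⁻¹

/-- The Lie subalgebra `ĝ^M` of `M`-invariant vectors. -/
def fixed : LieSubalgebra ℂ (Affine D.B) where
  carrier := {x | D.affM x = x}
  add_mem' := by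
    intro a b ha hb
    simp only [Set.mem_ofPred_eq] at ha hb ⊢
    rw [map_add, ha, hb]
  zero_mem' := map_zero _
  smul_mem' := by
    intro c a ha
    simp only [Set.mem_ofPred_eq] at ha ⊢
    rw [map_smul, ha]
  lie_mem' := by
    intro a b ha hb
    change D.affM a = a at ha
    change D.affM b = b at hb
    change D.affM ⁅a, b⁆ = ⁅a, b⁆
    rw [affM, twist_lie _ _ (inv_ne_zero D.η_ne_zero)]
    change ⁅D.affM a, D.affM b⁆ = _
    rw [ha, hb]

theorem mem_fixed {x : Affine D.B} : x ∈ D.fixed ↔ D.affM x = x := Iff.rfl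

/-- The projector `x ↦ h⁻¹ ∑_{k=1}^h M^k x` onto `ĝ^M`. -/
def proj (x : Affine D.B) : Affine D.B :=
  (D.h : ℂ)⁻¹ • ∑ k ∈ Finset.Icc 1 D.h, (D.affM ^ k) x

theorem σ_pow_A (k : ℕ) (α : H.root) :
    ∃ β, rootFun β = (D.M ^ k) (rootFun α) ∧ ((D.σ : g →ₗ[ℂ] g) ^ k) (D.A α) = D.A β := by
  induction k with
  | zero => exact ⟨α, by simp, by simp⟩
  | succ k ih =>
    obtain ⟨β, h1, h2⟩ := ih
    obtain ⟨γ, h3, h4⟩ := D.σ_A β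
    refine ⟨γ, ?_, ?_⟩
    · rw [h3, h1, pow_succ']; rfl
    · rw [pow_succ', Module.End.mul_apply, h2, ← h4]; rfl

theorem σ_pow_cartan (k : ℕ) (x : H) :
    ∃ y : H, (y : g) = ((D.σ : g →ₗ[ℂ] g) ^ k) x ∧ ∀ l : Dual ℂ H, (D.M ^ k) l y = l x := by
  induction k with
  | zero => exact ⟨x, by simp, by simp⟩
  | succ k ih =>
    obtain ⟨y, h1, h2⟩ := ih
    obtain ⟨z, h3, h4⟩ := D.σ_cartan y
    refine ⟨z, ?_, fun l => ?_⟩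
    · rw [h3, pow_succ', Module.End.mul_apply, ← h1]; rfl
    · rw [pow_succ', LinearEquiv.mul_apply, h4, h2]

/-- The automorphism `σ` has order dividing `h`. -/
theorem σ_pow_h (x : g) : ((D.σ : g →ₗ[ℂ] g) ^ D.h) x = x := by
  have hM : D.M ^ D.h = 1 := pow_orderOf_eq_one D.M
  have htop : (⊤ : Submodule ℂ g) ≤ LinearMap.eqLocus ((D.σ : g →ₗ[ℂ] g) ^ D.h) LinearMap.id := by
    have := LieModule.iSup_genWeightSpace_eq_top' ℂ H g
    rw [← LieSubmodule.toSubmodule_inj, LieSubmodule.iSup_toSubmodule,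
      LieSubmodule.top_toSubmodule] at this
    rw [← this, iSup_le_iff]
    intro χ v hv
    simp only [LinearMap.mem_eqLocus, LinearMap.id_apply]
    by_cases hχ : χ.IsZero
    · have hv' : v ∈ LieAlgebra.rootSpace H (0 : H → ℂ) := by
        have : (χ : H → ℂ) = 0 := hχ
        rw [← this]; exact hv
      rw [LieAlgebra.rootSpace_zero_eq] at hv'
      obtain ⟨y, h1, h2⟩ := D.σ_pow_cartan D.h ⟨v, hv'⟩
      rw [hM] at h2
      have : y = ⟨v, hv'⟩ := by
        rw [← sub_eq_zero, ← Module.forall_dual_apply_eq_zero_iff ℂ]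
        intro l
        rw [map_sub, sub_eq_zero]; exact h2 l
      rw [← h1, this]
    · let α : H.root := ⟨χ, by simpa using hχ⟩
      obtain ⟨β, h1, h2⟩ := D.σ_pow_A D.h α
      rw [hM] at h1
      have : β = α := (LieAlgebra.IsKilling.rootSystem H).root.injective h1
      rw [this] at h2
      have hfr := LieAlgebra.IsKilling.finrank_rootSpace_eq_one χ hχ
      obtain ⟨c, hc⟩ := (finrank_eq_one_iff_of_nonzero' (⟨D.A α, D.A_mem α⟩ :
        LieAlgebra.rootSpace H χ) (by simpa [Subtype.ext_iff] using D.A_ne_zero α)).mp hfr ⟨v, hv⟩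
      have hc' : v = c • D.A α := (congrArg Subtype.val hc).symm
      rw [hc', map_smul, h2]
  exact htop (Submodule.mem_top (x := x))

theorem proj_t_mem (X : g) (n : ℤ) : D.proj (Affine.t D.B X n) ∈ D.fixed := by
  have hpow : (D.affM ^ D.h) (Affine.t D.B X n) = Affine.t D.B X n := by
    rw [affM, twist_pow_tpow, D.σ_pow_h, ← zpow_natCast, ← zpow_mul, mul_comm, zpow_mul,
      zpow_natCast, inv_pow, D.η_pow_h]
    simp
  rw [mem_fixed, proj, map_smul, map_sum]
  congr 1
  have e (k : ℕ) : D.affM ((D.affM ^ k) (Affine.t D.B X n)) =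
      (D.affM ^ (k + 1)) (Affine.t D.B X n) := by
    rw [pow_succ', Module.End.mul_apply]
  simp only [e]
  have h2 := Finset.sum_range_succ' (fun k => (D.affM ^ k) (Affine.t D.B X n)) D.h
  have h3 := Finset.sum_range_succ (fun k => (D.affM ^ k) (Affine.t D.B X n)) D.h
  have r (f : ℕ → Affine D.B) : ∑ k ∈ Finset.Icc 1 D.h, f k = ∑ k ∈ Finset.range D.h, f (k + 1) := by
    rw [Finset.range_eq_Ico, Finset.sum_Ico_add' f 0 D.h 1]; rfl
  rw [r, r]
  have h4 : ∑ k ∈ Finset.range D.h, (D.affM ^ (k + 1)) (Affine.t D.B X n) =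
      ∑ k ∈ Finset.range D.h, (D.affM ^ k) (Affine.t D.B X n) := by
    rw [h2, hpow] at h3; simpa using h3
  have h5 := Finset.sum_range_succ' (fun k => (D.affM ^ (k + 1)) (Affine.t D.B X n)) D.h
  have h6 := Finset.sum_range_succ (fun k => (D.affM ^ (k + 1)) (Affine.t D.B X n)) D.h
  have h7 : (D.affM ^ (D.h + 1)) (Affine.t D.B X n) = (D.affM ^ (0 + 1)) (Affine.t D.B X n) := by
    rw [pow_succ', Module.End.mul_apply, hpow]; simp
  rw [h5, h7] at h6
  exact add_right_cancel h6

/-- The element `h⁻¹ ∑_{k=1}^h M^k (X tⁿ)` of `ĝ^M`. -/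
def mode (X : g) (n : ℤ) : D.fixed := ⟨D.proj (Affine.t D.B X n), D.proj_t_mem X n⟩

/-- The central element `K`, as an element of `ĝ^M`. -/
def K : D.fixed := ⟨Affine.K D.B, by
  rw [mem_fixed]; ext1 <;> simp [affM, Affine.K]⟩

/-! ### The Fock space, vertex operators and the coefficients -/

/-- The index set `E_+` of pairs `(i, n)`; the pair stands for the number `m_i + n h`. -/
abbrev Eplus (_D : PrincipalData H) : Type := Fin (Module.finrank ℂ H) × ℕ

/-- The number `m_i + n h`. -/
def deg (p : D.Eplus) : ℕ := D.m p.1 + p.2 * D.h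

/-- The Fock space `ℂ[y_m | m ∈ E_+]`. -/
abbrev Fock : Type := MvPolynomial D.Eplus ℂ

/-- Multiplication by `y_p`. -/
def mulY (p : D.Eplus) : Module.End ℂ D.Fock := LinearMap.mulLeft ℂ (MvPolynomial.X p)

/-- The derivative `∂/∂y_p`. -/
def dY (p : D.Eplus) : Module.End ℂ D.Fock := (MvPolynomial.pderiv p).toLinearMap

/-- A representation of `ĝ^M` on the Fock space that extends the standard level 1 representation
of the Heisenberg subalgebra: `K ↦ 1/h` and, for `m = m_i + n h` in `E_+`, `H_{i,m} ↦ ∂/∂y_m` and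
`H_{N+1-i,-m} ↦ m y_m`. -/
structure IsPrincipalRealization (ρ : D.fixed →ₗ[ℂ] Module.End ℂ D.Fock) : Prop where
  map_lie : ∀ x y : D.fixed, ρ ⁅x, y⁆ = ρ x * ρ y - ρ y * ρ x
  map_K : ρ D.K = (D.h : ℂ)⁻¹ • 1
  map_pos : ∀ p : D.Eplus, ρ (D.mode (D.e p.1) (D.deg p)) = D.dY p
  map_neg : ∀ p : D.Eplus,
    ρ (D.mode (D.e (Fin.rev p.1)) (-(D.deg p : ℤ))) = (D.deg p : ℂ) • D.mulY p

/-- The exponential `∑ fⁿ/n!` of a formal power series without constant term; only the terms with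
`n ≤ k` contribute to the coefficient of degree `k`. -/
def fexp {R : Type*} [Ring R] [Algebra ℂ R] (f : PowerSeries R) : PowerSeries R :=
  PowerSeries.mk fun k => ∑ n ∈ Finset.range (k + 1),
    ((n.factorial : ℂ)⁻¹) • PowerSeries.coeff k (f ^ n)

/-- The series `∑_{m ∈ E_+} l(H_{a(m)}) y_m ζ^m` in `ζ`; as `m_i > 0`, the coefficient of `ζ^r`
only involves pairs `(i, n)` with `n ≤ r`. -/
def creation (l : Dual ℂ H) : PowerSeries (Module.End ℂ D.Fock) :=
  PowerSeries.mk fun r => ∑ i, ∑ n ∈ Finset.range (r + 1),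
    if D.deg (i, n) = r then l (D.e i) • D.mulY (i, n) else 0

/-- The series `-∑_{m ∈ E_+} l(H_{a(-m)}) ∂_{y_m} ζ^{-m}/m`, as a power series in `ζ⁻¹`. -/
def annihilation (l : Dual ℂ H) : PowerSeries (Module.End ℂ D.Fock) :=
  PowerSeries.mk fun r => -∑ i, ∑ n ∈ Finset.range (r + 1),
    if D.deg (i, n) = r then (l (D.e (Fin.rev i)) / (r : ℂ)) • D.dY (i, n) else 0

/-- The vertex operator
`Γ^l(ζ) = exp(∑ l(H_{a(m)}) y_m ζ^m) exp(-∑ l(H_{a(-m)}) ∂_{y_m} ζ^{-m}/m)`, through the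
coefficients of `ζ^{-s}` applied to a vector `v`. The sum is finite, since the second factor applied
to the polynomial `v` is a polynomial in `ζ⁻¹`. -/
def vertex (l : Dual ℂ H) (s : ℤ) (v : D.Fock) : D.Fock :=
  ∑ᶠ p : ℕ × ℕ, if (p.1 : ℤ) - p.2 = -s then
    PowerSeries.coeff p.1 (fexp (D.creation l)) (PowerSeries.coeff p.2 (fexp (D.annihilation l)) v)
  else 0

/-- The coefficient of `ζ^{-s}` in `X(ζ) ⊗ Y(ζ)`, applied to `u ⊗ v`, where `X(ζ) = ∑ X_n ζ^{-n}`
and `Y(ζ) = ∑ Y_n ζ^{-n}` are series of operators on the Fock space with `X_n u = 0` and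
`Y_n v = 0` for all large `n` (so that the sum is finite). -/
def tensorCoeff (X Y : ℤ → D.Fock → D.Fock) (s : ℤ) (u v : D.Fock) : D.Fock ⊗[ℂ] D.Fock :=
  ∑ᶠ n : ℤ, X n u ⊗ₜ[ℂ] Y (s - n) v

/-- The series `x_α(ζ) = ∑_n A_{α,n} ζ^{-n}` in the representation `ρ`, through its coefficients. -/
def current (ρ : D.fixed →ₗ[ℂ] Module.End ℂ D.Fock) (α : H.root) (n : ℤ) (v : D.Fock) : D.Fock :=
  ρ (D.mode (D.A α) n) v

/-- `a` is the Kac--Wakimoto coefficient of the root `α`: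
`h / (A_α | A_{-α}) x_α(ζ) ⊗ x_{-α}(ζ) = a Γ^α(ζ) ⊗ Γ^{-α}(ζ)`. -/
def IsKWCoefficient (ρ : D.fixed →ₗ[ℂ] Module.End ℂ D.Fock) (α : H.root) (a : ℂ) : Prop :=
  ∀ (s : ℤ) (u v : D.Fock),
    ((D.h : ℂ) / D.B.form (D.A α) (D.A (negRoot α))) •
        D.tensorCoeff (D.current ρ α) (D.current ρ (negRoot α)) s u v =
      a • D.tensorCoeff (D.vertex (rootFun α)) (D.vertex (-rootFun α)) s u v

end PrincipalData

end Data

end KacWakimoto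

end

/-!
The Fock space is generated from the vacuum `1` by the Heisenberg operators `y_p` and `∂_p`, so a
family of operators whose commutators with the Heisenberg operators are prescribed is determined by
the vacuum coefficients of its values on the vacuum (`eq_zero_of_commutators`). The root operators
`A_{α,n}` and the coefficients of the vertex operator `Γ^α(ζ)` have the same commutators, by
`lie_heisenberg_mode_A` and by `dY_mul_vertexOp`, `mulY_mul_vertexOp`. The element `d` of `ĝ^M` acts
as minus the Euler operator plus a constant (`dElt_apply`), which forces the vacuum coefficient of
`A_{α,n} 1` to vanish for `n ≠ 0`. Hence `x_α(ζ) = c_α Γ^α(ζ)` for a constant `c_α`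
(`rootOp_eq_smul_vertexOp`), and `c_α c_{-α}` has to be computed.

Let `F_r` be the vacuum coefficient of `A_{α,r} A_{-α,-r} 1`, so that `F_0 = c_α c_{-α}`. There are
two descriptions of the series `F = ∑ F_r z^r`.

* The Euler identity for `A_{-α,-r} 1` gives `r F_r = ∑ S_m F_{r-m}`, where `S_m` is the Fourier
  transform `∑_k (α | M^k α) η^{km}` (`twoPoint_succ`). Therefore
  `F = F_0 ∏_k (1 - η^k z)^{-(α | M^k α)}`, and the exponents are integers because the coroots
  correspond to the roots under the form (`exists_root_vectors`).
* For `r > 0` the operator `A_{α,r}` annihilates the vacuum, so `F_r` is the vacuum coefficient of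
  the commutator `[A_{α,r}, A_{-α,-r}] 1`. Thus `F_r = ∑_k η^{-kr} (u_k + r v_k)` with
  `v_k = h⁻² (M^k A_α | A_{-α})` (`twoPoint_eq_sum`).

The double pole at `z = 1` has the coefficient `F_0 ∏_{0<k<h} (1 - η^k)^{-(α | M^k α)}` in the first
description and `h⁻² (A_α | A_{-α})` in the second. The comparison, carried out with formal power
series in `double_pole_comparison`, gives the value of the coefficient. It is the only possible one,
since `Γ^α(ζ) ⊗ Γ^{-α}(ζ)` has the term `1 ⊗ 1` in degree `0` on the vacuum.
-/

noncomputable section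

namespace KacWakimoto

/-! ### Power series with poles of order at most two -/

open PowerSeries in
/-- A formal linear differential equation `y' = y T` determines `y` by its constant term. -/
theorem eq_zero_of_derivative_eq_mul {y T : PowerSeries ℂ} (hy : derivative ℂ y = y * T)
    (h0 : constantCoeff y = 0) : y = 0 := by
  ext n
  induction n using Nat.strong_induction_on with
  | _ n ih =>
    cases n with
    | zero => simpa using h0
    | succ n =>
      have h := congrArg (coeff n) hy
      rw [coeff_derivative, coeff_mul, Finset.sum_eq_zero] at h
      · have hn : (n : ℂ) + 1 ≠ 0 := by exact_mod_cast n.succ_ne_zero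
        simpa [hn] using h
      · rintro ⟨i, j⟩ hij
        rw [Finset.HasAntidiagonal.mem_antidiagonal] at hij
        rw [ih i (by dsimp only at hij; omega)]
        simp

/-- The linear factor `1 - w X`, as a polynomial. -/
def linFactor (w : ℂ) : Polynomial ℂ := 1 - Polynomial.C w * Polynomial.X

/-- The series `∑ wⁿ⁺¹ Xⁿ = w / (1 - w X)`. -/
def geomSeries (w : ℂ) : PowerSeries ℂ := PowerSeries.mk fun n => w ^ (n + 1)

theorem linFactor_mul_geomSeries (w : ℂ) :
    (linFactor w : PowerSeries ℂ) * geomSeries w = PowerSeries.C w := by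
  ext n
  simp only [linFactor, geomSeries, Polynomial.coe_sub, Polynomial.coe_one, Polynomial.coe_mul,
    Polynomial.coe_C, Polynomial.coe_X, sub_mul, one_mul, mul_assoc, map_sub,
    PowerSeries.coeff_C_mul, PowerSeries.coeff_mk, PowerSeries.coeff_C]
  cases n with
  | zero => simp
  | succ n => rw [PowerSeries.coeff_succ_X_mul]; simp; ring

/-- Logarithmic derivative of a product of linear factors. -/
theorem derivative_prod_linFactor {ι : Type*} (s : Finset ι) (w : ι → ℂ) (p : ι → ℕ) :
    PowerSeries.derivative ℂ (∏ k ∈ s, (linFactor (w k) : PowerSeries ℂ) ^ p k) =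
      (∏ k ∈ s, (linFactor (w k) : PowerSeries ℂ) ^ p k) *
        -∑ k ∈ s, (p k : PowerSeries ℂ) * geomSeries (w k) := by
  classical
  induction s using Finset.induction_on with
  | empty => simp
  | insert a s ha ih =>
    have h1 : PowerSeries.derivative ℂ (linFactor (w a) : PowerSeries ℂ) =
        -((linFactor (w a) : PowerSeries ℂ) * geomSeries (w a)) := by
      rw [linFactor_mul_geomSeries]
      simp [linFactor]
    have h2 : PowerSeries.derivative ℂ ((linFactor (w a) : PowerSeries ℂ) ^ p a) =
        (linFactor (w a) : PowerSeries ℂ) ^ p a * -(p a * geomSeries (w a)) := by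
      rw [PowerSeries.derivative_pow, h1]
      rcases hp : p a with _ | q
      · simp
      · rw [Nat.add_sub_cancel, pow_succ]; ring
    rw [Finset.prod_insert ha, Finset.sum_insert ha, Derivation.leibniz, ih, h2, smul_eq_mul,
      smul_eq_mul]
    ring

/-- If `X F' = F ∑ₖ nₖ wₖ X / (1 - wₖ X)`, then `F = F(0) ∏ₖ (1 - wₖ X)^{-nₖ}`; the denominators
are cleared by writing `nₖ` as a difference of natural numbers. -/
theorem mul_prod_linFactor_eq {ι : Type*} (s : Finset ι) (w : ι → ℂ) (n : ι → ℤ) (F : ℕ → ℂ)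
    (hF : ∀ r : ℕ, ((r : ℂ) + 1) * F (r + 1) =
      ∑ x ∈ Finset.HasAntidiagonal.antidiagonal r, F x.1 * ∑ k ∈ s, (n k : ℂ) * w k ^ (x.2 + 1)) :
    PowerSeries.mk F * ∏ k ∈ s, (linFactor (w k) : PowerSeries ℂ) ^ (n k).toNat =
      PowerSeries.C (F 0) * ∏ k ∈ s, (linFactor (w k) : PowerSeries ℂ) ^ (-n k).toNat := by
  set p : ι → ℕ := fun k => (n k).toNat
  set q : ι → ℕ := fun k => (-n k).toNat
  have hpq (k : ι) : (n k : ℂ) = (p k : ℂ) - (q k : ℂ) := by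
    have : (n k : ℤ) = (p k : ℤ) - (q k : ℤ) := by simp only [p, q]; omega
    exact_mod_cast congrArg (Int.cast : ℤ → ℂ) this
  have hF' : PowerSeries.derivative ℂ (PowerSeries.mk F) = PowerSeries.mk F *
      ∑ k ∈ s, ((p k : PowerSeries ℂ) - (q k : PowerSeries ℂ)) * geomSeries (w k) := by
    ext r
    rw [PowerSeries.coeff_derivative, PowerSeries.coeff_mk, PowerSeries.coeff_mul, mul_comm, hF]
    refine Finset.sum_congr rfl fun x _ => ?_
    rw [PowerSeries.coeff_mk, map_sum]
    refine congrArg _ (Finset.sum_congr rfl fun k _ => ?_)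
    have : ((p k : PowerSeries ℂ) - (q k : PowerSeries ℂ)) = PowerSeries.C (n k : ℂ) := by
      rw [hpq, map_sub, map_natCast, map_natCast]
    rw [this, PowerSeries.coeff_C_mul, geomSeries, PowerSeries.coeff_mk]
  rw [← sub_eq_zero]
  refine eq_zero_of_derivative_eq_mul
    (T := -∑ k ∈ s, (q k : PowerSeries ℂ) * geomSeries (w k)) ?_ ?_
  · rw [map_sub, Derivation.leibniz, Derivation.leibniz, derivative_prod_linFactor,
      derivative_prod_linFactor, hF', PowerSeries.derivative_C]
    simp only [smul_eq_mul, sub_mul, Finset.sum_sub_distrib]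
    ring
  · have h1 (w : ℂ) : PowerSeries.constantCoeff (linFactor w : PowerSeries ℂ) = 1 := by
      simp [linFactor]
    simp [map_prod, h1]

/-- A power series is regular at `1` if it is a rational function without pole at `1`. -/
def RegularAtOne (y : PowerSeries ℂ) : Prop :=
  ∃ Q W : Polynomial ℂ, Q.eval 1 ≠ 0 ∧ (Q : PowerSeries ℂ) * y = W

theorem RegularAtOne.add {y z : PowerSeries ℂ} (hy : RegularAtOne y) (hz : RegularAtOne z) :
    RegularAtOne (y + z) := by
  obtain ⟨Q, W, h1, h2⟩ := hy
  obtain ⟨Q', W', h1', h2'⟩ := hz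
  refine ⟨Q * Q', Q' * W + Q * W', by simp [h1, h1'], ?_⟩
  simp only [Polynomial.coe_mul, Polynomial.coe_add, ← h2, ← h2']
  ring

theorem RegularAtOne.coe (W : Polynomial ℂ) : RegularAtOne (W : PowerSeries ℂ) :=
  ⟨1, W, by simp, by simp⟩

theorem RegularAtOne.sum {ι : Type*} (s : Finset ι) (y : ι → PowerSeries ℂ)
    (h : ∀ k ∈ s, RegularAtOne (y k)) : RegularAtOne (∑ k ∈ s, y k) := by
  classical
  induction s using Finset.induction_on with
  | empty => simpa using RegularAtOne.coe 0
  | insert a s ha ih =>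
    rw [Finset.sum_insert ha]
    exact (h a (by simp)).add (ih fun k hk => h k (by simp [hk]))

/-- The series `∑ wⁿ (u + n v) Xⁿ = u / (1 - w X) + v w X / (1 - w X)²`. -/
def poleSeries (w u v : ℂ) : PowerSeries ℂ := PowerSeries.mk fun n => w ^ n * (u + n * v)

theorem linFactor_sq_mul_poleSeries (w u v : ℂ) :
    ((linFactor w ^ 2 : Polynomial ℂ) : PowerSeries ℂ) * poleSeries w u v =
      ((Polynomial.C u * linFactor w + Polynomial.C (v * w) * Polynomial.X : Polynomial ℂ) :
        PowerSeries ℂ) := by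
  have key : ((linFactor w : Polynomial ℂ) : PowerSeries ℂ) * poleSeries w u v =
      PowerSeries.C u + PowerSeries.C v * PowerSeries.X * geomSeries w := by
    ext n
    simp only [linFactor, poleSeries, geomSeries, Polynomial.coe_sub, Polynomial.coe_one,
      Polynomial.coe_mul, Polynomial.coe_C, Polynomial.coe_X, sub_mul, one_mul, mul_assoc, map_sub,
      map_add, PowerSeries.coeff_C_mul, PowerSeries.coeff_mk, PowerSeries.coeff_C]
    cases n with
    | zero => simp
    | succ n =>
      rw [PowerSeries.coeff_succ_X_mul, PowerSeries.coeff_succ_X_mul]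
      simp
      ring
  rw [pow_two, Polynomial.coe_mul, mul_assoc, key, mul_add, mul_left_comm,
    linFactor_mul_geomSeries]
  simp only [Polynomial.coe_add, Polynomial.coe_mul, Polynomial.coe_C, Polynomial.coe_X, map_mul]
  ring

theorem RegularAtOne.poleSeries {w : ℂ} (hw : w ≠ 1) (u v : ℂ) :
    RegularAtOne (poleSeries w u v) :=
  ⟨_, _, by simpa [linFactor, sub_eq_zero] using hw.symm, linFactor_sq_mul_poleSeries w u v⟩

/-- Comparison of the double poles at `1` of a power series that is known both as a product
`F(0) ∏ₖ (1 - wₖ X)^{-nₖ}`, with `w = 1` occurring for the index `b` only and with `n_b = 2`, and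
as a sum of principal parts with poles of order at most two. -/
theorem double_pole_comparison {ι : Type*} [DecidableEq ι] (s : Finset ι) (b : ι) (hb : b ∉ s)
    (w w' : ι → ℂ) (n : ι → ℤ) (u v : ι → ℂ) (F : ℕ → ℂ)
    (hwb : w b = 1) (hw'b : w' b = 1) (hw : ∀ k ∈ s, w k ≠ 1) (hw' : ∀ k ∈ s, w' k ≠ 1)
    (hn : n b = 2)
    (hF : ∀ r : ℕ, ((r : ℂ) + 1) * F (r + 1) =
      ∑ x ∈ Finset.HasAntidiagonal.antidiagonal r,
        F x.1 * ∑ k ∈ insert b s, (n k : ℂ) * w k ^ (x.2 + 1))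
    (hF' : ∀ r : ℕ, 0 < r → F r = ∑ k ∈ insert b s, w' k ^ r * (u k + r * v k)) :
    F 0 = v b * ∏ k ∈ s, (1 - w k) ^ n k := by
  have h1 := mul_prod_linFactor_eq (insert b s) w n F hF
  rw [Finset.prod_insert hb, Finset.prod_insert hb, hn, hwb] at h1
  -- away from the index `b` all principal parts are regular at `1`
  have hreg : RegularAtOne (PowerSeries.mk F - poleSeries 1 (u b) (v b)) := by
    have h2 : PowerSeries.mk F - poleSeries 1 (u b) (v b) =
        ((Polynomial.C (F 0 - ∑ k ∈ insert b s, u k) : Polynomial ℂ) : PowerSeries ℂ) +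
          ∑ k ∈ s, poleSeries (w' k) (u k) (v k) := by
      ext r
      rw [map_sub, map_add, map_sum, PowerSeries.coeff_mk, poleSeries, PowerSeries.coeff_mk,
        Polynomial.coe_C, PowerSeries.coeff_C]
      simp only [poleSeries, PowerSeries.coeff_mk]
      rcases Nat.eq_zero_or_pos r with rfl | hr
      · simp [Finset.sum_insert hb]; ring
      · rw [hF' r hr, Finset.sum_insert hb, hw'b, if_neg hr.ne']; ring
    rw [h2]
    exact (RegularAtOne.coe _).add
      (RegularAtOne.sum _ _ fun k hk => RegularAtOne.poleSeries (hw' k hk) _ _)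
  obtain ⟨Q, W, hQ, hW⟩ := hreg
  -- both descriptions, multiplied by `(1 - X)²` and a common denominator, are polynomials
  have h3 : Q * (Polynomial.C (u b) * linFactor 1 + Polynomial.C (v b) * Polynomial.X) *
      ∏ k ∈ s, linFactor (w k) ^ (n k).toNat + linFactor 1 ^ 2 * W *
      ∏ k ∈ s, linFactor (w k) ^ (n k).toNat =
      Q * (Polynomial.C (F 0) * ∏ k ∈ s, linFactor (w k) ^ (-n k).toNat) := by
    have hp := linFactor_sq_mul_poleSeries 1 (u b) (v b)
    rw [mul_one] at hp
    have hprod (p : ι → ℕ) : ((∏ k ∈ s, linFactor (w k) ^ p k : Polynomial ℂ) : PowerSeries ℂ) =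
        ∏ k ∈ s, (linFactor (w k) : PowerSeries ℂ) ^ p k := by
      rw [← Polynomial.coeToPowerSeries.ringHom_apply, map_prod]
      simp
    rw [← Polynomial.coe_inj]
    simp only [Polynomial.coe_mul, Polynomial.coe_add, hprod, ← hW, Polynomial.coe_pow,
      Polynomial.coe_C] at hp ⊢
    rw [← hp]
    rw [show (2 : ℤ).toNat = 2 from rfl, show (-2 : ℤ).toNat = 0 from rfl] at h1
    linear_combination (Q : PowerSeries ℂ) * h1
  have h4 := congrArg (Polynomial.eval 1) h3
  simp only [Polynomial.eval_add, Polynomial.eval_mul, Polynomial.eval_prod, Polynomial.eval_pow,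
    Polynomial.eval_C, Polynomial.eval_X, linFactor, Polynomial.eval_sub, Polynomial.eval_one,
    mul_one, sub_self, mul_zero, zero_add, ne_eq, OfNat.ofNat_ne_zero, not_false_eq_true, zero_pow,
    zero_mul, add_zero, mul_assoc] at h4
  have h5 := mul_left_cancel₀ hQ h4
  have h6 : (∏ k ∈ s, (1 - w k) ^ n k) * ∏ k ∈ s, (1 - w k) ^ (-n k).toNat =
      ∏ k ∈ s, (1 - w k) ^ (n k).toNat := by
    rw [← Finset.prod_mul_distrib]
    refine Finset.prod_congr rfl fun k hk => ?_
    have hk1 : (1 - w k) ≠ 0 := sub_ne_zero.mpr (hw k hk).symm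
    rw [← zpow_natCast, ← zpow_natCast, ← zpow_add₀ hk1]
    congr 1; omega
  have h7 : ∏ k ∈ s, (1 - w k) ^ (-n k).toNat ≠ 0 :=
    Finset.prod_ne_zero_iff.mpr fun k hk => pow_ne_zero _ (sub_ne_zero.mpr (hw k hk).symm)
  refine mul_right_cancel₀ h7 ?_
  rw [← h5, ← h6]
  ring

open Module (Dual)

namespace PrincipalData

/-! ### Exponentials of power series with operator coefficients -/

section Exponential

variable {R : Type*} [Ring R]

theorem coeff_pow_eq_zero {f : PowerSeries R} (hf : PowerSeries.constantCoeff f = 0) {k n : ℕ}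
    (h : k < n) : PowerSeries.coeff k (f ^ n) = 0 :=
  PowerSeries.coeff_of_lt_order _ (lt_of_lt_of_le (by exact_mod_cast h)
    (PowerSeries.le_order_pow_of_constantCoeff_eq_zero n hf))

/-- The coefficient of `Xᵏ` for an integer `k`, which is zero for `k < 0`. -/
def zcoeff (f : PowerSeries R) (k : ℤ) : R := if 0 ≤ k then PowerSeries.coeff k.toNat f else 0

theorem zcoeff_natCast (f : PowerSeries R) (k : ℕ) : zcoeff f k = PowerSeries.coeff k f := by
  simp [zcoeff]

theorem zcoeff_of_neg (f : PowerSeries R) {k : ℤ} (h : k < 0) : zcoeff f k = 0 := by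
  simp [zcoeff, h]

variable [Algebra ℂ R]

/-- The summation range in the coefficients of the exponential may be enlarged. -/
theorem coeff_fexp {f : PowerSeries R} (hf : PowerSeries.constantCoeff f = 0) {k K : ℕ}
    (h : k < K) : PowerSeries.coeff k (fexp f) =
      ∑ n ∈ Finset.range K, ((n.factorial : ℂ)⁻¹) • PowerSeries.coeff k (f ^ n) := by
  rw [fexp, PowerSeries.coeff_mk]
  refine Finset.sum_subset (Finset.range_mono h) fun n _ hn => ?_
  rw [coeff_pow_eq_zero hf (by simpa using hn), smul_zero]

theorem coeff_zero_fexp (f : PowerSeries R) : PowerSeries.coeff 0 (fexp f) = 1 := by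
  simp [fexp]

/-- If the commutator of `D` and `f` is the central series `c Xᵈ`, then the commutator of `D` and
`fⁿ` is `n c Xᵈ fⁿ⁻¹`. -/
theorem commutator_pow {f : PowerSeries R} {D : R} {c : ℂ} {d : ℕ}
    (h : PowerSeries.C D * f = f * PowerSeries.C D + c • PowerSeries.X ^ d) (n : ℕ) :
    PowerSeries.C D * f ^ n = f ^ n * PowerSeries.C D +
      ((n : ℂ) * c) • (PowerSeries.X ^ d * f ^ (n - 1)) := by
  induction n with
  | zero => simp
  | succ n ih =>
    rw [pow_succ, ← mul_assoc, ih, add_mul, mul_assoc, h, mul_add, ← mul_assoc, smul_mul_assoc,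
      mul_smul_comm, (PowerSeries.commute_X_pow (f ^ n) d).eq, add_assoc, ← pow_succ, mul_assoc,
      ← pow_succ, Nat.add_sub_cancel]
    congr 1
    rcases n with _ | n
    · simp
    · rw [Nat.add_sub_cancel, ← add_smul]; congr 1; push_cast; ring

/-- If the commutator of `D` and `f` is the central series `c Xᵈ`, then the commutator of `D` and
`exp f` is `c Xᵈ exp f`. -/
theorem commutator_fexp {f : PowerSeries R} (hf : PowerSeries.constantCoeff f = 0) {D : R} {c : ℂ}
    {d : ℕ} (hd : 0 < d)
    (h : PowerSeries.C D * f = f * PowerSeries.C D + c • PowerSeries.X ^ d) (k : ℤ) :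
    D * zcoeff (fexp f) k = zcoeff (fexp f) k * D + c • zcoeff (fexp f) (k - d) := by
  rcases lt_or_ge k 0 with hk | hk
  · rw [zcoeff_of_neg _ hk, zcoeff_of_neg _ (by omega)]; simp
  lift k to ℕ using hk
  rw [zcoeff_natCast, coeff_fexp hf (Nat.lt_succ_self k), Finset.mul_sum, Finset.sum_mul]
  have e (n : ℕ) : D * ((n.factorial : ℂ)⁻¹ • PowerSeries.coeff k (f ^ n)) =
      ((n.factorial : ℂ)⁻¹ • PowerSeries.coeff k (f ^ n)) * D +
        c • (((n.factorial : ℂ)⁻¹ * n) • zcoeff (f ^ (n - 1)) ((k : ℤ) - d)) := by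
    have h1 := congrArg (PowerSeries.coeff k) (commutator_pow h n)
    rw [PowerSeries.coeff_C_mul, map_add, PowerSeries.coeff_mul_C, PowerSeries.coeff_smul,
      PowerSeries.coeff_X_pow_mul'] at h1
    have h2 : zcoeff (f ^ (n - 1)) ((k : ℤ) - d) =
        if d ≤ k then PowerSeries.coeff (k - d) (f ^ (n - 1)) else 0 := by
      by_cases hdk : d ≤ k
      · rw [if_pos hdk, ← Nat.cast_sub hdk, zcoeff_natCast]
      · rw [if_neg hdk, zcoeff_of_neg _ (by omega)]
    rw [mul_smul_comm, h1, h2, smul_add, smul_mul_assoc, smul_smul, smul_smul]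
    congr 2
    ring
  rw [Finset.sum_congr rfl fun n _ => e n, Finset.sum_add_distrib, ← Finset.smul_sum]
  congr 2
  rw [Finset.sum_range_succ']
  have e2 (n : ℕ) : (((n + 1).factorial : ℂ)⁻¹ * ((n + 1 : ℕ) : ℂ)) = (n.factorial : ℂ)⁻¹ := by
    rw [Nat.factorial_succ]
    have h1 : ((n + 1 : ℕ) : ℂ) ≠ 0 := by exact_mod_cast n.succ_ne_zero
    push_cast at h1 ⊢
    rw [mul_inv]
    field_simp
  simp only [e2, Nat.add_sub_cancel]
  rcases lt_or_ge k d with hkd | hkd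
  · rw [zcoeff_of_neg _ (by omega)]
    simp [zcoeff_of_neg (k := (k : ℤ) - d) _ (by omega)]
  · rw [← Nat.cast_sub hkd]
    simp only [zcoeff_natCast]
    rw [coeff_fexp hf (K := k) (by omega)]
    simp

end Exponential

section Fock

variable {g : Type*} [LieRing g] [LieAlgebra ℂ g] [FiniteDimensional ℂ g]
  [LieAlgebra.IsSimple ℂ g] {H : LieSubalgebra ℂ g} [H.IsCartanSubalgebra] (D : PrincipalData H)

/-! ### The Heisenberg relations and the vertex operators -/

theorem h_pos (p : D.Eplus) : 0 < D.h := (Nat.zero_le _).trans_lt (D.m_lt p.1)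

theorem deg_pos (p : D.Eplus) : 0 < D.deg p := Nat.add_pos_left (D.m_pos p.1) _

theorem snd_le_deg (p : D.Eplus) : p.2 ≤ D.deg p :=
  (Nat.le_mul_of_pos_right _ (D.h_pos p)).trans (Nat.le_add_left _ _)

theorem dY_apply (p : D.Eplus) (v : D.Fock) : D.dY p v = MvPolynomial.pderiv p v := rfl

theorem mulY_apply (p : D.Eplus) (v : D.Fock) : D.mulY p v = MvPolynomial.X p * v := rfl

theorem dY_one (p : D.Eplus) : D.dY p 1 = 0 := MvPolynomial.pderiv_one

theorem dY_mul_mulY (p q : D.Eplus) :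
    D.dY p * D.mulY q = D.mulY q * D.dY p + if q = p then 1 else 0 := by
  refine LinearMap.ext fun v => ?_
  by_cases h : q = p
  · subst h
    simp [dY_apply, mulY_apply, Derivation.leibniz]
  · simp [dY_apply, mulY_apply, Derivation.leibniz, MvPolynomial.pderiv_X_of_ne h, h]

theorem dY_mul_dY (p q : D.Eplus) : D.dY p * D.dY q = D.dY q * D.dY p := by
  refine LinearMap.ext fun v => ?_
  ext s
  simp only [Module.End.mul_apply, dY_apply, MvPolynomial.coeff_pderiv]
  by_cases h : p = q
  · subst h; ring
  · have h1 : (s + fun₀ | p => 1) q = s q := by simp [h]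
    have h2 : (s + fun₀ | q => 1) p = s p := by simp [Ne.symm h]
    rw [h1, h2, add_right_comm]; ring

theorem mulY_mul_mulY (p q : D.Eplus) : D.mulY p * D.mulY q = D.mulY q * D.mulY p := by
  refine LinearMap.ext fun v => ?_
  simp only [Module.End.mul_apply, mulY_apply]; ring

/-- A sum over `i` and `n ≤ r` supported on the pairs of degree `r` picks out a pair `p` exactly
when `p` has degree `r`. -/
theorem sum_deg_single {E : Type*} [AddCommMonoid E] (p : D.Eplus) (r : ℕ) (x : E) :
    (∑ i, ∑ n ∈ Finset.range (r + 1),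
      if D.deg (i, n) = r then (if (i, n) = p then x else 0) else 0) =
      if r = D.deg p then x else 0 := by
  have e (i : Fin (Module.finrank ℂ H)) (n : ℕ) :
      (if D.deg (i, n) = r then (if (i, n) = p then x else 0) else 0) =
        if i = p.1 then (if n = p.2 then (if r = D.deg p then x else 0) else 0) else 0 := by
    by_cases hp : (i, n) = p
    · subst hp; simp [eq_comm]
    · have : ¬ (i = p.1 ∧ n = p.2) := fun h => hp (Prod.ext h.1 h.2)
      rw [not_and] at this
      by_cases hi : i = p.1
      · rw [if_neg hp, if_pos hi, if_neg (this hi), ite_self]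
      · simp [hp, hi]
  simp only [e]
  rw [Finset.sum_comm]
  simp only [Finset.sum_ite_eq', Finset.mem_univ, if_true, Finset.mem_range]
  by_cases hr : r = D.deg p
  · rw [if_pos (by rw [hr]; exact Nat.lt_succ_of_le (D.snd_le_deg p))]
  · simp [hr]

theorem coeff_annihilation (l : Dual ℂ H) (r : ℕ) :
    PowerSeries.coeff r (D.annihilation l) = ∑ i, ∑ n ∈ Finset.range (r + 1),
      if D.deg (i, n) = r then (-(l (D.e (Fin.rev i)) / (r : ℂ))) • D.dY (i, n) else 0 := by
  rw [annihilation, PowerSeries.coeff_mk]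
  have e : ∀ A B : Module.End ℂ D.Fock, A + B = 0 → -A = B := fun A B h =>
    neg_eq_of_add_eq_zero_right h
  apply e
  rw [← Finset.sum_add_distrib]
  refine Finset.sum_eq_zero fun i _ => ?_
  rw [← Finset.sum_add_distrib]
  refine Finset.sum_eq_zero fun n _ => ?_
  split_ifs
  · rw [← add_smul, add_neg_cancel, zero_smul]
  · simp

theorem constantCoeff_creation (l : Dual ℂ H) :
    PowerSeries.constantCoeff (D.creation l) = 0 := by
  rw [← PowerSeries.coeff_zero_eq_constantCoeff_apply, creation, PowerSeries.coeff_mk]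
  refine Finset.sum_eq_zero fun i _ => Finset.sum_eq_zero fun n _ => ?_
  rw [if_neg (D.deg_pos _).ne']

theorem constantCoeff_annihilation (l : Dual ℂ H) :
    PowerSeries.constantCoeff (D.annihilation l) = 0 := by
  rw [← PowerSeries.coeff_zero_eq_constantCoeff_apply, coeff_annihilation]
  refine Finset.sum_eq_zero fun i _ => Finset.sum_eq_zero fun n _ => ?_
  rw [if_neg (D.deg_pos _).ne']

theorem dY_commutator_creation (l : Dual ℂ H) (p : D.Eplus) :
    PowerSeries.C (D.dY p) * D.creation l = D.creation l * PowerSeries.C (D.dY p) +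
      l (D.e p.1) • PowerSeries.X ^ D.deg p := by
  ext1 r
  rw [map_add, PowerSeries.coeff_C_mul, PowerSeries.coeff_mul_C, PowerSeries.coeff_smul,
    PowerSeries.coeff_X_pow, creation, PowerSeries.coeff_mk, Finset.mul_sum, Finset.sum_mul,
    smul_ite, smul_zero, ← D.sum_deg_single p r, ← Finset.sum_add_distrib]
  refine Finset.sum_congr rfl fun i _ => ?_
  rw [Finset.mul_sum, Finset.sum_mul, ← Finset.sum_add_distrib]
  refine Finset.sum_congr rfl fun n _ => ?_
  split_ifs with h1 h2
  · subst h2; simp [dY_mul_mulY]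
  · simp [dY_mul_mulY, h2]
  · simp

theorem mulY_commutator_creation (l : Dual ℂ H) (p : D.Eplus) :
    PowerSeries.C (D.mulY p) * D.creation l = D.creation l * PowerSeries.C (D.mulY p) := by
  ext1 r
  rw [PowerSeries.coeff_C_mul, PowerSeries.coeff_mul_C, creation, PowerSeries.coeff_mk,
    Finset.mul_sum, Finset.sum_mul]
  refine Finset.sum_congr rfl fun i _ => ?_
  rw [Finset.mul_sum, Finset.sum_mul]
  refine Finset.sum_congr rfl fun n _ => ?_
  split_ifs with h1
  · simp [mulY_mul_mulY]
  · simp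

theorem dY_commutator_annihilation (l : Dual ℂ H) (p : D.Eplus) :
    PowerSeries.C (D.dY p) * D.annihilation l = D.annihilation l * PowerSeries.C (D.dY p) := by
  ext1 r
  rw [PowerSeries.coeff_C_mul, PowerSeries.coeff_mul_C, coeff_annihilation, Finset.mul_sum,
    Finset.sum_mul]
  refine Finset.sum_congr rfl fun i _ => ?_
  rw [Finset.mul_sum, Finset.sum_mul]
  refine Finset.sum_congr rfl fun n _ => ?_
  split_ifs with h1
  · rw [mul_smul_comm, smul_mul_assoc, D.dY_mul_dY p]
  · simp

theorem mulY_commutator_annihilation (l : Dual ℂ H) (p : D.Eplus) :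
    PowerSeries.C (D.mulY p) * D.annihilation l = D.annihilation l * PowerSeries.C (D.mulY p) +
      (l (D.e (Fin.rev p.1)) / (D.deg p : ℂ)) • PowerSeries.X ^ D.deg p := by
  ext1 r
  rw [map_add, PowerSeries.coeff_C_mul, PowerSeries.coeff_mul_C, PowerSeries.coeff_smul,
    PowerSeries.coeff_X_pow, coeff_annihilation, Finset.mul_sum, Finset.sum_mul, smul_ite,
    smul_zero, ← D.sum_deg_single p r, ← Finset.sum_add_distrib]
  refine Finset.sum_congr rfl fun i _ => ?_
  rw [Finset.mul_sum, Finset.sum_mul, ← Finset.sum_add_distrib]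
  refine Finset.sum_congr rfl fun n _ => ?_
  split_ifs with h1 h2
  · subst h2
    rw [smul_mul_assoc, mul_smul_comm, D.dY_mul_mulY, if_pos rfl, h1, smul_add, add_assoc,
      ← add_smul, neg_add_cancel, zero_smul, add_zero]
  · rw [smul_mul_assoc, mul_smul_comm, D.dY_mul_mulY, if_neg (Ne.symm h2), add_zero, add_zero]
  · simp

/-- The coefficients of `exp(∑ l(H_{a(m)}) y_m ζ^m)`. -/
def crea (l : Dual ℂ H) (k : ℤ) : Module.End ℂ D.Fock := zcoeff (fexp (D.creation l)) k

/-- The coefficients of `exp(-∑ l(H_{a(-m)}) ∂_{y_m} ζ^{-m}/m)`, as a series in `ζ⁻¹`. -/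
def annih (l : Dual ℂ H) (k : ℤ) : Module.End ℂ D.Fock := zcoeff (fexp (D.annihilation l)) k

variable (l : Dual ℂ H)

theorem dY_crea (p : D.Eplus) (k : ℤ) :
    D.dY p * D.crea l k = D.crea l k * D.dY p + l (D.e p.1) • D.crea l (k - D.deg p) :=
  commutator_fexp (D.constantCoeff_creation l) (D.deg_pos p) (D.dY_commutator_creation l p) k

theorem mulY_crea (p : D.Eplus) (k : ℤ) : D.mulY p * D.crea l k = D.crea l k * D.mulY p := by
  have := commutator_fexp (D.constantCoeff_creation l) (d := 1) one_pos (D := D.mulY p) (c := 0)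
    (by rw [mulY_commutator_creation]; simp) k
  rwa [zero_smul, add_zero] at this

theorem dY_annih (p : D.Eplus) (k : ℤ) : D.dY p * D.annih l k = D.annih l k * D.dY p := by
  have := commutator_fexp (D.constantCoeff_annihilation l) (d := 1) one_pos (D := D.dY p) (c := 0)
    (by rw [dY_commutator_annihilation]; simp) k
  rwa [zero_smul, add_zero] at this

theorem mulY_annih (p : D.Eplus) (k : ℤ) :
    D.mulY p * D.annih l k = D.annih l k * D.mulY p +
      (l (D.e (Fin.rev p.1)) / (D.deg p : ℂ)) • D.annih l (k - D.deg p) :=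
  commutator_fexp (D.constantCoeff_annihilation l) (D.deg_pos p)
    (D.mulY_commutator_annihilation l p) k

theorem crea_zero : D.crea l 0 = 1 := by
  rw [crea, ← Nat.cast_zero, zcoeff_natCast, coeff_zero_fexp]

theorem annih_zero : D.annih l 0 = 1 := by
  rw [annih, ← Nat.cast_zero, zcoeff_natCast, coeff_zero_fexp]

theorem crea_of_neg {k : ℤ} (hk : k < 0) : D.crea l k = 0 := zcoeff_of_neg _ hk

theorem annih_of_neg {k : ℤ} (hk : k < 0) : D.annih l k = 0 := zcoeff_of_neg _ hk

end Fock

section Vertex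

variable {g : Type*} [LieRing g] [LieAlgebra ℂ g] [FiniteDimensional ℂ g]
  [LieAlgebra.IsSimple ℂ g] {H : LieSubalgebra ℂ g} [H.IsCartanSubalgebra] (D : PrincipalData H)

/-- The coefficient of the vacuum `1` in a vector of the Fock space. -/
def vac : D.Fock →ₗ[ℂ] ℂ := (MvPolynomial.aeval (0 : D.Eplus → ℂ)).toLinearMap

theorem vac_apply (v : D.Fock) : D.vac v = MvPolynomial.constantCoeff v := by
  simp [vac, MvPolynomial.aeval_zero]

@[simp] theorem vac_one : D.vac 1 = 1 := by simp [vac_apply]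

@[simp] theorem vac_mulY (p : D.Eplus) (v : D.Fock) : D.vac (D.mulY p v) = 0 := by
  simp [vac_apply, mulY_apply]

/-- The Fock space is generated by the vacuum under the operators `y_p`. -/
theorem fock_induction {P : D.Fock → Prop} (h1 : P 1) (hadd : ∀ u v, P u → P v → P (u + v))
    (hsmul : ∀ (c : ℂ) v, P v → P (c • v)) (hY : ∀ p v, P v → P (D.mulY p v)) (v : D.Fock) :
    P v := by
  induction v using MvPolynomial.induction_on with
  | C a =>
    have : (MvPolynomial.C a : D.Fock) = a • 1 := by
      rw [MvPolynomial.smul_eq_C_mul, mul_one]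
    rw [this]; exact hsmul _ _ h1
  | add p q hp hq => exact hadd _ _ hp hq
  | mul_X q p hq =>
    rw [mul_comm]; exact hY p q hq

variable (l : Dual ℂ H)

/-- In positive degree the creation part of a vertex operator produces no vacuum coefficient, since
every term is divisible by some `y_p`. -/
theorem vac_crea (k : ℤ) (v : D.Fock) : D.vac (D.crea l k v) = if k = 0 then D.vac v else 0 := by
  rcases lt_or_ge k 0 with hk | hk
  · rw [crea_of_neg _ _ hk, if_neg hk.ne]; simp
  lift k to ℕ using hk
  have h1 (r : ℕ) (w : D.Fock) : D.vac (PowerSeries.coeff r (D.creation l) w) = 0 := by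
    rw [creation, PowerSeries.coeff_mk, LinearMap.sum_apply, map_sum]
    refine Finset.sum_eq_zero fun i _ => ?_
    rw [LinearMap.sum_apply, map_sum]
    refine Finset.sum_eq_zero fun n _ => ?_
    split_ifs <;> simp
  have h2 (r n : ℕ) (w : D.Fock) :
      D.vac (PowerSeries.coeff r (D.creation l ^ (n + 1)) w) = 0 := by
    rw [pow_succ', PowerSeries.coeff_mul, LinearMap.sum_apply, map_sum]
    exact Finset.sum_eq_zero fun x _ => h1 _ _
  rw [crea, zcoeff_natCast, coeff_fexp (D.constantCoeff_creation l) (Nat.lt_succ_self k),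
    LinearMap.sum_apply, map_sum, Finset.sum_range_succ', Finset.sum_eq_zero, zero_add]
  · simp only [Nat.factorial_zero, Nat.cast_one, inv_one, one_smul, pow_zero,
      PowerSeries.coeff_one, Nat.cast_eq_zero]
    split_ifs <;> simp
  · intro n _
    rw [LinearMap.smul_apply, map_smul, h2, smul_zero]

theorem annih_one {k : ℤ} (hk : k ≠ 0) : D.annih l k 1 = 0 := by
  rcases lt_or_ge k 0 with hk0 | hk0
  · rw [annih_of_neg _ _ hk0]; simp
  lift k to ℕ using hk0
  have h1 (r : ℕ) : PowerSeries.coeff r (D.annihilation l) 1 = 0 := by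
    rw [coeff_annihilation, LinearMap.sum_apply]
    refine Finset.sum_eq_zero fun i _ => ?_
    rw [LinearMap.sum_apply]
    refine Finset.sum_eq_zero fun n _ => ?_
    split_ifs <;> simp [dY_one]
  rw [annih, zcoeff_natCast, coeff_fexp (D.constantCoeff_annihilation l) (Nat.lt_succ_self k),
    LinearMap.sum_apply]
  refine Finset.sum_eq_zero fun n _ => ?_
  rcases n with _ | n
  · have : k ≠ 0 := by exact_mod_cast hk
    simp [PowerSeries.coeff_one, this]
  · rw [pow_succ, PowerSeries.coeff_mul, LinearMap.smul_apply, LinearMap.sum_apply,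
      Finset.sum_eq_zero, smul_zero]
    intro x _
    rw [Module.End.mul_apply, h1, map_zero]

/-- The annihilation part of a vertex operator is locally finite. -/
theorem exists_annih_eq_zero (v : D.Fock) : ∃ K : ℕ, ∀ b : ℤ, K ≤ b → D.annih l b v = 0 := by
  induction v using D.fock_induction with
  | h1 => exact ⟨1, fun b hb => D.annih_one l (by omega)⟩
  | hadd u v hu hv =>
    obtain ⟨K, hK⟩ := hu
    obtain ⟨K', hK'⟩ := hv
    exact ⟨max K K', fun b hb => by rw [map_add, hK b (by omega), hK' b (by omega), add_zero]⟩
  | hsmul c v hv =>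
    obtain ⟨K, hK⟩ := hv
    exact ⟨K, fun b hb => by rw [map_smul, hK b hb, smul_zero]⟩
  | hY p v hv =>
    obtain ⟨K, hK⟩ := hv
    refine ⟨K + D.deg p, fun b hb => ?_⟩
    push_cast at hb
    have h := LinearMap.congr_fun (D.mulY_annih l p b) v
    rw [LinearMap.add_apply, LinearMap.smul_apply, Module.End.mul_apply, Module.End.mul_apply,
      hK b (by omega), hK (b - D.deg p) (by omega), map_zero, smul_zero, add_zero] at h
    exact h.symm

/-- The vertex operator as a finite sum over the degree of the annihilation part. -/
theorem vertex_eq_sum (s : ℤ) (v : D.Fock) {K : ℕ}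
    (hK : ∀ b : ℤ, K ≤ b → D.annih l b v = 0) :
    D.vertex l s v = ∑ b ∈ Finset.range K, D.crea l (b - s) (D.annih l b v) := by
  classical
  have hinj : Function.Injective (fun b : ℕ => (((b : ℤ) - s).toNat, b)) :=
    fun b b' h => (Prod.ext_iff.mp h).2
  rw [vertex, finsum_eq_sum_of_support_subset
    (s := (Finset.range K).image fun b : ℕ => (((b : ℤ) - s).toNat, b)),
    Finset.sum_image hinj.injOn]
  · refine Finset.sum_congr rfl fun b _ => ?_
    rcases lt_or_ge ((b : ℤ) - s) 0 with h | h
    · rw [crea_of_neg _ _ h, if_neg (by dsimp only; omega), LinearMap.zero_apply]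
    · rw [if_pos (by dsimp only; omega), crea, annih, zcoeff_natCast, zcoeff, if_pos h]
  · rintro ⟨a, b⟩ hab
    rw [Function.mem_support] at hab
    have h1 : (a : ℤ) - b = -s := by
      by_contra h
      exact hab (if_neg h)
    rw [if_pos h1] at hab
    simp only [Finset.coe_image, Finset.coe_range, Set.mem_image, Set.mem_Iio, Prod.mk.injEq]
    refine ⟨b, ?_, by omega, rfl⟩
    by_contra hb
    refine hab ?_
    have := hK b (by omega)
    rw [annih, zcoeff_natCast] at this
    rw [this, map_zero]

/-- The coefficient of `ζ⁻ˢ` in the vertex operator, as a linear operator. -/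
def vertexOp (s : ℤ) : Module.End ℂ D.Fock where
  toFun := D.vertex l s
  map_add' u v := by
    obtain ⟨K, hK⟩ := D.exists_annih_eq_zero l u
    obtain ⟨K', hK'⟩ := D.exists_annih_eq_zero l v
    rw [D.vertex_eq_sum l s u (K := max K K') fun b hb => hK b (by omega),
      D.vertex_eq_sum l s v (K := max K K') fun b hb => hK' b (by omega),
      D.vertex_eq_sum l s (u + v) (K := max K K') fun b hb => by
        rw [map_add, hK b (by omega), hK' b (by omega), add_zero], ← Finset.sum_add_distrib]
    simp
  map_smul' c v := by
    obtain ⟨K, hK⟩ := D.exists_annih_eq_zero l v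
    rw [D.vertex_eq_sum l s v hK, D.vertex_eq_sum l s (c • v) (K := K) fun b hb => by
      rw [map_smul, hK b hb, smul_zero]]
    simp [Finset.smul_sum]

theorem vertexOp_apply (s : ℤ) (v : D.Fock) : D.vertexOp l s v = D.vertex l s v := rfl

theorem dY_mul_vertexOp (p : D.Eplus) (s : ℤ) : D.dY p * D.vertexOp l s =
    D.vertexOp l s * D.dY p + l (D.e p.1) • D.vertexOp l (s + D.deg p) := by
  refine LinearMap.ext fun v => ?_
  obtain ⟨K, hK⟩ := D.exists_annih_eq_zero l v
  have hK' (b : ℤ) (hb : K ≤ b) : D.annih l b (D.dY p v) = 0 := by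
    rw [← Module.End.mul_apply, ← dY_annih, Module.End.mul_apply, hK b hb, map_zero]
  simp only [LinearMap.add_apply, LinearMap.smul_apply, Module.End.mul_apply, vertexOp_apply]
  rw [D.vertex_eq_sum l s v hK, D.vertex_eq_sum l _ v hK, D.vertex_eq_sum l s _ hK', map_sum,
    Finset.smul_sum, ← Finset.sum_add_distrib]
  refine Finset.sum_congr rfl fun b _ => ?_
  have h := LinearMap.congr_fun (D.dY_crea l p (b - s)) (D.annih l b v)
  simp only [LinearMap.add_apply, LinearMap.smul_apply, Module.End.mul_apply] at h
  rw [h, ← Module.End.mul_apply (D.dY p), dY_annih, Module.End.mul_apply, sub_sub]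

theorem mulY_mul_vertexOp (p : D.Eplus) (s : ℤ) : D.mulY p * D.vertexOp l s =
    D.vertexOp l s * D.mulY p +
      (l (D.e (Fin.rev p.1)) / (D.deg p : ℂ)) • D.vertexOp l (s - D.deg p) := by
  refine LinearMap.ext fun v => ?_
  obtain ⟨K₀, hK₀⟩ := D.exists_annih_eq_zero l v
  obtain ⟨K₁, hK₁⟩ := D.exists_annih_eq_zero l (D.mulY p v)
  simp only [LinearMap.add_apply, LinearMap.smul_apply, Module.End.mul_apply, vertexOp_apply]
  rw [D.vertex_eq_sum l s v (K := D.deg p + (K₀ + K₁))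
      fun b hb => hK₀ b (by push_cast at hb; omega),
    D.vertex_eq_sum l s (D.mulY p v) (K := D.deg p + (K₀ + K₁))
      fun b hb => hK₁ b (by push_cast at hb; omega),
    D.vertex_eq_sum l _ v (K := K₀ + K₁) fun b hb => hK₀ b (by push_cast at hb; omega), map_sum]
  -- the two sums of annihilation terms differ by a shift of the index by the degree of `p`
  have hshift : ∑ b ∈ Finset.range (K₀ + K₁),
      D.crea l (b - (s - D.deg p)) (D.annih l b v) =
      ∑ b ∈ Finset.range (D.deg p + (K₀ + K₁)),
        D.crea l (b - s) (D.annih l (b - D.deg p) v) := by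
    rw [Finset.sum_range_add _ (D.deg p), Finset.sum_eq_zero (s := Finset.range (D.deg p)),
      zero_add]
    · refine Finset.sum_congr rfl fun b _ => ?_
      rw [show ((D.deg p + b : ℕ) : ℤ) - s = b - (s - D.deg p) by push_cast; ring,
        show ((D.deg p + b : ℕ) : ℤ) - D.deg p = b by push_cast; ring]
    · intro b hb
      rw [Finset.mem_range] at hb
      rw [annih_of_neg _ _ (by omega), LinearMap.zero_apply, map_zero]
  rw [hshift, Finset.smul_sum, ← Finset.sum_add_distrib]
  refine Finset.sum_congr rfl fun b _ => ?_
  have h := LinearMap.congr_fun (D.mulY_annih l p b) v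
  simp only [LinearMap.add_apply, LinearMap.smul_apply, Module.End.mul_apply] at h
  rw [← Module.End.mul_apply (D.mulY p), mulY_crea, Module.End.mul_apply, h, map_add, map_smul]

theorem vertex_one (s : ℤ) : D.vertex l s 1 = D.crea l (-s) 1 := by
  rw [D.vertex_eq_sum l s 1 (K := 1) fun b hb => D.annih_one l (by omega)]
  simp [annih_zero]

/-- A family of operators on the Fock space with the commutation relations of a vertex operator is
determined by the vacuum coefficients of its values on the vacuum. -/
theorem eq_zero_of_commutators (a b : D.Eplus → ℂ) (Z : ℤ → Module.End ℂ D.Fock)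
    (hd : ∀ p s, D.dY p * Z s = Z s * D.dY p + a p • Z (s + D.deg p))
    (hy : ∀ p s, D.mulY p * Z s = Z s * D.mulY p + b p • Z (s - D.deg p))
    (hvac : ∀ s, D.vac (Z s 1) = 0) (s : ℤ) : Z s = 0 := by
  -- on the vacuum, `∂_p Z_s = a_p Z_{s + deg p}` expresses each coefficient through a lower one
  have h1 (m : D.Eplus →₀ ℕ) : ∀ s, MvPolynomial.coeff m (Z s 1) = 0 := by
    induction hn : m.degree generalizing m with
    | zero =>
      intro s
      rw [Finsupp.degree_eq_zero_iff] at hn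
      have := hvac s
      rw [vac_apply] at this
      rw [hn]; exact this
    | succ n ih =>
      intro s
      have hm : m ≠ 0 := by rintro rfl; simp at hn
      obtain ⟨p, hp⟩ := Finsupp.ne_iff.mp hm
      obtain ⟨m', rfl⟩ : ∃ m', m = m' + Finsupp.single p 1 :=
        ⟨m - Finsupp.single p 1, (tsub_add_cancel_of_le (by
          rw [Finsupp.single_le_iff]; exact Nat.one_le_iff_ne_zero.mpr hp)).symm⟩
      have h2 := LinearMap.congr_fun (hd p s) 1
      rw [LinearMap.add_apply, Module.End.mul_apply, Module.End.mul_apply, dY_one, map_zero,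
        zero_add, LinearMap.smul_apply] at h2
      have h3 := congrArg (MvPolynomial.coeff m') h2
      rw [dY_apply, MvPolynomial.coeff_pderiv, MvPolynomial.coeff_smul,
        ih m' (by simpa using hn), smul_zero] at h3
      exact (mul_eq_zero.mp h3).resolve_right (by exact_mod_cast (m' p).succ_ne_zero)
  refine LinearMap.ext fun v => ?_
  rw [LinearMap.zero_apply]
  induction v using D.fock_induction generalizing s with
  | h1 => exact MvPolynomial.ext _ _ fun m => by rw [h1]; simp
  | hadd u v hu hv => rw [map_add, hu, hv, add_zero]
  | hsmul c v hv => rw [map_smul, hv, smul_zero]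
  | hY p v hv =>
    have h2 := LinearMap.congr_fun (hy p s) v
    rw [LinearMap.add_apply, Module.End.mul_apply, Module.End.mul_apply, LinearMap.smul_apply, hv,
      hv, map_zero, smul_zero, add_zero] at h2
    exact h2.symm

end Vertex

section LieTheory

variable {g : Type*} [LieRing g] [LieAlgebra ℂ g] [FiniteDimensional ℂ g]
  [LieAlgebra.IsSimple ℂ g] {H : LieSubalgebra ℂ g} [H.IsCartanSubalgebra] (D : PrincipalData H)

/-! ### The invariant form on roots -/

theorem rootFun_apply (α : H.root) (x : H) : rootFun α x = α.1 x := by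
  rw [rootFun, LieAlgebra.IsKilling.rootSystem_root_apply]; rfl

theorem rootFun_negRoot (α : H.root) : rootFun (negRoot α) = -rootFun α := by
  ext x
  rw [LinearMap.neg_apply, rootFun_apply, rootFun_apply, negRoot]
  simp

theorem lie_of_mem_rootSpace (α : H.root) {X : g} (hX : X ∈ LieAlgebra.rootSpace H α.1) (x : H) :
    ⁅(x : g), X⁆ = rootFun α x • X := by
  rw [rootFun_apply]
  exact LieAlgebra.IsKilling.lie_eq_smul_of_mem_rootSpace hX x

theorem lie_A (α : H.root) (x : H) : ⁅(x : g), D.A α⁆ = rootFun α x • D.A α :=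
  lie_of_mem_rootSpace α (D.A_mem α) x

/-- The Cartan subalgebra is orthogonal to the root spaces. -/
theorem form_cartan_A (α : H.root) (x : H) : D.B.form x (D.A α) = 0 := by
  obtain ⟨t, -, ht⟩ := D.normalized α
  have h1 := D.B.inv t x (D.A α)
  have h2 : ⁅(t : g), (x : g)⁆ = 0 := congrArg Subtype.val (LieModule.IsTrivial.trivial t x)
  rw [h2, map_zero, LinearMap.zero_apply, D.lie_A, ht, map_smul, smul_eq_mul] at h1
  simpa using h1

/-- An `sl₂`-triple of the root `α` is normalized by `(e | f) = 1`, and its semisimple element,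
the coroot, corresponds to `α` under the form. -/
theorem exists_root_vectors (α : H.root) : ∃ e f : g, e ∈ LieAlgebra.rootSpace H α.1 ∧
    f ∈ LieAlgebra.rootSpace H (negRoot α).1 ∧ D.B.form e f = 1 ∧
    D.flat (LieAlgebra.IsKilling.coroot α.1) = rootFun α := by
  obtain ⟨hh, e, f, ht, he, hf⟩ :=
    LieAlgebra.IsKilling.exists_isSl2Triple_of_weight_isNonZero (LieSubalgebra.isNonZero_coe_root α)
  have hc := ht.h_eq_coroot (LieSubalgebra.isNonZero_coe_root α) he hf
  have h1 (x : H) : D.B.form hh x = D.B.form e f * rootFun α x := by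
    rw [← ht.lie_e_f, D.B.inv, ← lie_skew, lie_of_mem_rootSpace α he, map_neg, neg_neg, map_smul,
      smul_eq_mul, mul_comm, D.B.symm.eq f e]
  obtain ⟨t, ht1, ht2⟩ := D.normalized α
  have h2 : LieAlgebra.IsKilling.coroot α.1 = D.B.form e f • t := by
    apply D.flat_bijective.1
    ext x
    rw [map_smul, LinearMap.smul_apply, flat_apply, flat_apply, ht1, ← hc, h1, smul_eq_mul]
  have h3 : rootFun α (LieAlgebra.IsKilling.coroot α.1) = 2 := by
    rw [rootFun_apply]
    exact LieAlgebra.IsKilling.root_apply_coroot (LieSubalgebra.isNonZero_coe_root α)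
  have h4 : D.B.form e f = 1 := by
    rw [h2, map_smul, ht2, smul_eq_mul] at h3
    linear_combination h3 / 2
  refine ⟨e, f, he, by simpa [negRoot] using hf, h4, ?_⟩
  ext x
  rw [flat_apply, ← hc, h1, h4, one_mul]

theorem exists_smul_A (α : H.root) {X : g} (hX : X ∈ LieAlgebra.rootSpace H α.1) :
    ∃ c : ℂ, X = c • D.A α := by
  obtain ⟨c, hc⟩ := (finrank_eq_one_iff_of_nonzero' (⟨D.A α, D.A_mem α⟩ :
    LieAlgebra.rootSpace H α.1) (by simpa [Subtype.ext_iff] using D.A_ne_zero α)).mp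
    (LieAlgebra.IsKilling.finrank_rootSpace_eq_one α.1 (LieSubalgebra.isNonZero_coe_root α)) ⟨X, hX⟩
  exact ⟨c, (congrArg Subtype.val hc).symm⟩

theorem form_A_negRoot_ne_zero (α : H.root) : D.B.form (D.A α) (D.A (negRoot α)) ≠ 0 := by
  obtain ⟨e, f, he, hf, h1, -⟩ := D.exists_root_vectors α
  obtain ⟨a, rfl⟩ := D.exists_smul_A α he
  obtain ⟨b, rfl⟩ := D.exists_smul_A (negRoot α) hf
  intro h
  simp [h] at h1

theorem dualForm_flat (l : Dual ℂ H) (x : H) : D.dualForm l (D.flat x) = l x := by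
  have h1 (l' : Dual ℂ H) : D.flat ((LinearEquiv.ofBijective D.flat D.flat_bijective).symm l') =
      l' := (LinearEquiv.ofBijective D.flat D.flat_bijective).apply_symm_apply l'
  have h2 : (LinearEquiv.ofBijective D.flat D.flat_bijective).symm (D.flat x) = x :=
    (LinearEquiv.ofBijective D.flat D.flat_bijective).symm_apply_apply x
  simp only [dualForm]
  rw [h2, ← flat_apply, h1]

theorem dualForm_root_self (α : H.root) : D.dualForm (rootFun α) (rootFun α) = 2 := by
  obtain ⟨t, ht1, ht2⟩ := D.normalized α
  have : D.flat t = rootFun α := LinearMap.ext ht1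
  nth_rewrite 2 [← this]
  rw [dualForm_flat, ht2]

/-- The scalar product of two roots is an integer. -/
theorem exists_int_dualForm (α β : H.root) :
    ∃ n : ℤ, D.dualForm (rootFun α) (rootFun β) = n := by
  obtain ⟨-, -, -, -, -, h⟩ := D.exists_root_vectors β
  rw [← h, dualForm_flat, rootFun_apply]
  exact ⟨_, LieAlgebra.IsKilling.apply_coroot_eq_cast β.1 α.1⟩

/-! ### The eigenbasis of the Coxeter element -/

theorem cast_h_ne_zero (hh : 0 < D.h) : (D.h : ℂ) ≠ 0 := by exact_mod_cast hh.ne'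

theorem form_e' (i j : Fin (Module.finrank ℂ H)) :
    D.B.form (D.e i) (D.e j) = if j = Fin.rev i then (D.h : ℂ) else 0 := D.form_e i j

theorem σ_e' (i : Fin (Module.finrank ℂ H)) : D.σ (D.e i) = D.η ^ D.m i • (D.e i : g) := D.σ_e i

/-- The exponents `m_i` and `m_{N+1-i}` add up to a multiple of `h`, because the automorphism
preserves the form. -/
theorem η_pow_m_mul_rev (hh : 0 < D.h) (i : Fin (Module.finrank ℂ H)) :
    D.η ^ D.m i * D.η ^ D.m (Fin.rev i) = 1 := by
  have h1 := D.B.map_equiv D.σ (D.e i) (D.e (Fin.rev i))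
  rw [σ_e', σ_e', map_smul, map_smul, LinearMap.smul_apply, form_e', if_pos rfl, smul_eq_mul,
    smul_eq_mul, ← mul_assoc] at h1
  have := mul_right_cancel₀ (D.cast_h_ne_zero hh) (h1.trans (one_mul _).symm)
  rw [← this, mul_comm]

theorem dualForm_eq_sum (hh : 0 < D.h) (l l' : Dual ℂ H) :
    D.dualForm l l' = (D.h : ℂ)⁻¹ * ∑ i, l (D.e (Fin.rev i)) * l' (D.e i) := by
  have h0 := D.cast_h_ne_zero hh
  obtain ⟨x, rfl⟩ := D.flat_bijective.2 l'
  rw [dualForm_flat]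
  have h1 (i : Fin (Module.finrank ℂ H)) :
      D.flat x (D.e i) = D.h * D.e.repr x (Fin.rev i) := by
    conv_lhs => rw [← D.e.sum_repr x]
    rw [map_sum, LinearMap.sum_apply, Finset.sum_eq_single (Fin.rev i)]
    · rw [map_smul, LinearMap.smul_apply, flat_apply, form_e', Fin.rev_rev, if_pos rfl,
        smul_eq_mul, mul_comm]
    · intro j _ hj
      rw [map_smul, LinearMap.smul_apply, flat_apply, form_e', if_neg, smul_zero]
      rintro rfl
      exact hj (Fin.rev_rev j).symm
    · simp
  conv_lhs => rw [← D.e.sum_repr x]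
  rw [map_sum, ← Equiv.sum_comp Fin.revPerm, Finset.mul_sum]
  refine Finset.sum_congr rfl fun i _ => ?_
  rw [h1, map_smul, smul_eq_mul, Fin.revPerm_apply]
  field_simp

/-- The Coxeter element acts on functionals by the inverse transpose, whence the inverse
eigenvalue. -/
theorem M_pow_apply_e (l : Dual ℂ H) (i : Fin (Module.finrank ℂ H)) (k : ℕ) :
    (D.M ^ k) l (D.e i) = ((D.η ^ D.m i)⁻¹) ^ k * l (D.e i) := by
  induction k with
  | zero => simp
  | succ k ih =>
    obtain ⟨y, h1, h2⟩ := D.σ_cartan (D.e i)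
    rw [σ_e'] at h1
    have h3 : y = D.η ^ D.m i • D.e i := Subtype.ext (by rw [h1]; rfl)
    have h4 := h2 ((D.M ^ k) l)
    rw [h3, map_smul, smul_eq_mul, ih] at h4
    have h5 : D.η ^ D.m i ≠ 0 := pow_ne_zero _ D.η_ne_zero
    rw [pow_succ', LinearEquiv.mul_apply, pow_succ, mul_right_comm, mul_comm _ (D.η ^ D.m i)⁻¹,
      ← h4, inv_mul_cancel_left₀ h5]

theorem isPrimitiveRoot_η (hh : 0 < D.h) : IsPrimitiveRoot D.η D.h :=
  Complex.isPrimitiveRoot_exp D.h hh.ne'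

theorem sum_pow_eq_ite {n : ℕ} {z : ℂ} (hz : z ^ n = 1) :
    ∑ k ∈ Finset.Icc 1 n, z ^ k = if z = 1 then (n : ℂ) else 0 := by
  split_ifs with h
  · simp [h]
  · rw [← Finset.Ico_add_one_right_eq_Icc, Finset.sum_Ico_eq_sum_range, Nat.add_sub_cancel]
    simp only [pow_add, pow_one, ← Finset.mul_sum]
    rw [geom_sum_eq h, hz, sub_self, zero_div, mul_zero]

theorem η_pow_eq_iff (hh : 0 < D.h) (i : Fin (Module.finrank ℂ H)) (r : ℕ) :
    D.η ^ r * (D.η ^ D.m i)⁻¹ = 1 ↔ r % D.h = D.m i := by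
  have hη := D.isPrimitiveRoot_η hh
  rw [mul_inv_eq_one₀ (pow_ne_zero _ D.η_ne_zero), ← pow_mod_orderOf, ← hη.eq_orderOf]
  exact ⟨fun h => hη.pow_inj (Nat.mod_lt _ hh) (D.m_lt i) h, fun h => by rw [h]⟩

/-- The discrete Fourier transform of `k ↦ (α | Mᵏ α)` is given by the products of the components
of `α` along the eigenbasis. -/
theorem sum_dualForm_mul_pow (hh : 0 < D.h) (l : Dual ℂ H) (r : ℕ) :
    ∑ k ∈ Finset.Icc 1 D.h, D.dualForm l ((D.M ^ k) l) * (D.η ^ k) ^ r =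
      ∑ i, if r % D.h = D.m i then l (D.e i) * l (D.e (Fin.rev i)) else 0 := by
  have h0 := D.cast_h_ne_zero hh
  simp only [D.dualForm_eq_sum hh, M_pow_apply_e, Finset.mul_sum, Finset.sum_mul]
  rw [Finset.sum_comm]
  refine Finset.sum_congr rfl fun i _ => ?_
  have hz : (D.η ^ r * (D.η ^ D.m i)⁻¹) ^ D.h = 1 := by
    rw [mul_pow, inv_pow, ← pow_mul, ← pow_mul, mul_comm r, mul_comm (D.m i), pow_mul, pow_mul,
      D.η_pow_h, one_pow, one_pow, inv_one, mul_one]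
  have h1 := sum_pow_eq_ite hz
  simp only [D.η_pow_eq_iff hh] at h1
  have h2 (k : ℕ) : (D.h : ℂ)⁻¹ * (l (D.e (Fin.rev i)) * (((D.η ^ D.m i)⁻¹) ^ k * l (D.e i))) *
      (D.η ^ k) ^ r = (D.h : ℂ)⁻¹ * (l (D.e i) * l (D.e (Fin.rev i))) *
        (D.η ^ r * (D.η ^ D.m i)⁻¹) ^ k := by
    rw [mul_pow, ← pow_mul D.η r k, mul_comm r k, pow_mul]; ring
  simp only [h2]
  rw [← Finset.mul_sum, h1]
  split_ifs
  · field_simp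
  · simp

/-! ### Commutators in the algebra of invariants -/

theorem proj_smul (c : ℂ) (x : Affine D.B) : D.proj (c • x) = c • D.proj x := by
  simp only [proj, map_smul, ← Finset.smul_sum, smul_comm c]

theorem proj_add (x y : Affine D.B) : D.proj (x + y) = D.proj x + D.proj y := by
  simp only [proj, map_add, Finset.sum_add_distrib, smul_add]

theorem proj_sum {ι : Type*} (s : Finset ι) (x : ι → Affine D.B) :
    D.proj (∑ k ∈ s, x k) = ∑ k ∈ s, D.proj (x k) := by
  simp only [proj, map_sum, ← Finset.smul_sum]
  rw [Finset.sum_comm]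

theorem affM_pow_of_mem {x : Affine D.B} (hx : x ∈ D.fixed) (k : ℕ) : (D.affM ^ k) x = x := by
  induction k with
  | zero => simp
  | succ k ih => rw [pow_succ', Module.End.mul_apply, ih]; exact hx

theorem proj_of_mem (hh : 0 < D.h) {x : Affine D.B} (hx : x ∈ D.fixed) : D.proj x = x := by
  rw [proj, Finset.sum_congr rfl fun k _ => D.affM_pow_of_mem hx k, Finset.sum_const,
    Nat.card_Icc, Nat.add_sub_cancel, ← Nat.cast_smul_eq_nsmul ℂ, smul_smul,
    inv_mul_cancel₀ (D.cast_h_ne_zero hh), one_smul]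

theorem lie_proj {x : Affine D.B} (hx : x ∈ D.fixed) (y : Affine D.B) :
    ⁅x, D.proj y⁆ = D.proj ⁅x, y⁆ := by
  have h1 (k : ℕ) : (D.affM ^ k) ⁅x, y⁆ = ⁅x, (D.affM ^ k) y⁆ := by
    induction k with
    | zero => simp
    | succ k ih =>
      rw [pow_succ', Module.End.mul_apply, ih, Module.End.mul_apply, affM,
        twist_lie _ _ (inv_ne_zero D.η_ne_zero)]
      exact congrArg (⁅·, _⁆) hx
  simp only [proj, lie_smul, lie_sum, h1]

theorem K_mem : Affine.K D.B ∈ D.fixed := D.K.2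

theorem d_mem : Affine.d D.B ∈ D.fixed := by
  rw [mem_fixed]; ext1 <;> simp [affM, Affine.d]

/-- The element `d` of `ĝ^M`. -/
def dElt : D.fixed := ⟨Affine.d D.B, D.d_mem⟩

theorem coe_mode (X : g) (n : ℤ) : (D.mode X n : Affine D.B) = D.proj (Affine.t D.B X n) := rfl

theorem coe_K : (D.K : Affine D.B) = Affine.K D.B := rfl

theorem mode_smul (c : ℂ) (X : g) (n : ℤ) : D.mode (c • X) n = c • D.mode X n := by
  refine Subtype.ext ?_
  have h1 : Affine.t D.B (c • X) n = c • Affine.t D.B X n := by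
    ext1 <;> simp [Affine.t, tpow]
  change D.proj _ = c • D.proj _
  rw [h1, proj_smul]

theorem lie_dElt_mode (X : g) (n : ℤ) : ⁅D.dElt, D.mode X n⁆ = (n : ℂ) • D.mode X n := by
  refine Subtype.ext ?_
  change ⁅Affine.d D.B, D.proj _⁆ = (n : ℂ) • D.proj _
  rw [D.lie_proj D.d_mem, Affine.d_lie, proj_smul]

theorem lie_mode_of_mem (hh : 0 < D.h) {X : g} {n : ℤ} (hX : Affine.t D.B X n ∈ D.fixed) (Y : g)
    (m : ℤ) : ⁅D.mode X n, D.mode Y m⁆ =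
      D.mode ⁅X, Y⁆ (n + m) + (if n = -m then (n : ℂ) * D.B.form X Y else 0) • D.K := by
  refine Subtype.ext ?_
  change ⁅D.proj _, D.proj _⁆ = D.proj _ + _ • Affine.K D.B
  rw [D.proj_of_mem hh hX, D.lie_proj hX, Affine.t_lie, proj_add, proj_smul,
    D.proj_of_mem hh D.K_mem]

/-- The commutator of two modes of opposite degree, expanded over the powers of the automorphism
applied to the first of them. -/
theorem lie_mode_neg (hh : 0 < D.h) (X Y : g) (n : ℤ) : ⁅D.mode X n, D.mode Y (-n)⁆ =
    (D.h : ℂ)⁻¹ • ∑ k ∈ Finset.Icc 1 D.h, (D.η⁻¹ ^ n) ^ k •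
      (D.mode ⁅((D.σ : g →ₗ[ℂ] g) ^ k) X, Y⁆ 0 +
        ((n : ℂ) * D.B.form (((D.σ : g →ₗ[ℂ] g) ^ k) X) Y) • D.K) := by
  refine Subtype.ext ?_
  simp only [LieSubalgebra.coe_bracket, SetLike.val_smul, AddMemClass.coe_add,
    AddSubmonoidClass.coe_finsetSum, coe_mode, coe_K]
  have hX : D.proj (Affine.t D.B X n) =
    (D.h : ℂ)⁻¹ • ∑ k ∈ Finset.Icc 1 D.h, (D.affM ^ k) (Affine.t D.B X n) := rfl
  have hpow (k : ℕ) : (D.affM ^ k) (Affine.t D.B X n) =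
      (D.η⁻¹ ^ n) ^ k • Affine.t D.B (((D.σ : g →ₗ[ℂ] g) ^ k) X) n :=
    twist_pow_tpow D.B D.σ D.η⁻¹ X n k
  rw [D.lie_proj (D.proj_t_mem X n), hX, smul_lie, sum_lie, proj_smul, proj_sum]
  refine congrArg _ (Finset.sum_congr rfl fun k _ => ?_)
  rw [hpow, smul_lie, Affine.t_lie, neg_neg, if_pos rfl, add_neg_cancel, proj_smul, proj_add,
    proj_smul, D.proj_of_mem hh D.K_mem]

theorem t_mem_fixed_of_eigen {X : g} {n : ℤ} {c : ℂ} (hX : D.σ X = c • X) (hc : c = D.η ^ n) :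
    Affine.t D.B X n ∈ D.fixed := by
  rw [mem_fixed]
  have h1 := twist_pow_tpow D.B D.σ D.η⁻¹ X n 1
  rw [pow_one, pow_one, pow_one] at h1
  rw [affM, h1]
  have h2 : Affine.t D.B ((D.σ : g →ₗ[ℂ] g) X) n = c • Affine.t D.B X n := by
    have : (D.σ : g →ₗ[ℂ] g) X = c • X := hX
    rw [this]
    ext1 <;> simp [Affine.t, tpow]
  rw [h2, smul_smul, hc, ← mul_zpow, inv_mul_cancel₀ D.η_ne_zero, one_zpow, one_smul]

theorem η_pow_deg (p : D.Eplus) : D.η ^ D.deg p = D.η ^ D.m p.1 := by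
  rw [deg, pow_add, mul_comm p.2, pow_mul, D.η_pow_h, one_pow, mul_one]

theorem t_pos_mem (p : D.Eplus) : Affine.t D.B (D.e p.1 : g) (D.deg p) ∈ D.fixed :=
  D.t_mem_fixed_of_eigen (D.σ_e' p.1) (by rw [zpow_natCast, η_pow_deg])

theorem t_neg_mem (p : D.Eplus) :
    Affine.t D.B (D.e (Fin.rev p.1) : g) (-(D.deg p : ℤ)) ∈ D.fixed :=
  D.t_mem_fixed_of_eigen (D.σ_e' _) (by
    rw [zpow_neg, zpow_natCast, η_pow_deg]
    exact eq_inv_of_mul_eq_one_right (D.η_pow_m_mul_rev (D.h_pos p) p.1))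

/-- The elements of the Heisenberg subalgebra act on the root modes by shifts. -/
theorem lie_heisenberg_mode_A (hh : 0 < D.h) {x : H} {n : ℤ}
    (hx : Affine.t D.B (x : g) n ∈ D.fixed) (α : H.root) (m : ℤ) :
    ⁅D.mode x n, D.mode (D.A α) m⁆ = rootFun α x • D.mode (D.A α) (m + n) := by
  rw [D.lie_mode_of_mem hh hx, D.form_cartan_A, D.lie_A, mode_smul, add_comm n m]
  simp

end LieTheory

section Realization

variable {g : Type*} [LieRing g] [LieAlgebra ℂ g] [FiniteDimensional ℂ g]
  [LieAlgebra.IsSimple ℂ g] {H : LieSubalgebra ℂ g} [H.IsCartanSubalgebra] {D : PrincipalData H}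
  {ρ : D.fixed →ₗ[ℂ] Module.End ℂ D.Fock}

/-! ### The tensor product of two vertex operators -/

theorem tensorCoeff_smul (c c' : ℂ) (X Y : ℤ → D.Fock → D.Fock) (s : ℤ) (u v : D.Fock) :
    D.tensorCoeff (fun n w => c • X n w) (fun n w => c' • Y n w) s u v =
      (c * c') • D.tensorCoeff X Y s u v := by
  rw [tensorCoeff, tensorCoeff, smul_finsum]
  refine finsum_congr fun n => ?_
  rw [TensorProduct.smul_tmul_smul]

theorem tensorCoeff_vertex_ne_zero (l l' : Dual ℂ H) :
    D.tensorCoeff (D.vertex l) (D.vertex l') 0 1 1 ≠ 0 := by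
  have h1 : D.tensorCoeff (D.vertex l) (D.vertex l') 0 1 1 = (1 : D.Fock) ⊗ₜ[ℂ] (1 : D.Fock) := by
    rw [tensorCoeff, finsum_eq_single _ 0]
    · rw [sub_zero, vertex_one, vertex_one, neg_zero, crea_zero, crea_zero, Module.End.one_apply]
    · intro n hn
      rcases lt_or_gt_of_ne hn with h | h
      · rw [D.vertex_one l', D.crea_of_neg l' (by omega), LinearMap.zero_apply,
          TensorProduct.tmul_zero]
      · rw [D.vertex_one l, D.crea_of_neg l (by omega), LinearMap.zero_apply,
          TensorProduct.zero_tmul]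
  rw [h1]
  intro h2
  have h3 := congrArg (TensorProduct.lift (LinearMap.mul ℂ ℂ) ∘ TensorProduct.map D.vac D.vac) h2
  simp at h3

/-! ### Root operators of a principal realization -/

/-- The pairs `p` of degree at most `r`. -/
def degLE (D : PrincipalData H) (r : ℕ) : Finset D.Eplus :=
  (Finset.univ ×ˢ Finset.range (r + 1)).filter fun p => D.deg p ≤ r

theorem mem_degLE {r : ℕ} {p : D.Eplus} : p ∈ D.degLE r ↔ D.deg p ≤ r := by
  simp only [degLE, Finset.mem_filter, Finset.mem_product, Finset.mem_univ, Finset.mem_range,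
    true_and, and_iff_right_iff_imp]
  exact fun h => Nat.lt_succ_of_le ((D.snd_le_deg p).trans h)

theorem h_pos_of_root (D : PrincipalData H) (α : H.root) : 0 < D.h := by
  obtain ⟨t, -, ht⟩ := D.normalized α
  have : Nontrivial H := ⟨t, 0, by rintro rfl; simp at ht⟩
  exact D.h_pos (D.e.index_nonempty.some, 0)

/-- The operator `A_{α,n}` on the Fock space. -/
def rootOp (ρ : D.fixed →ₗ[ℂ] Module.End ℂ D.Fock) (α : H.root) (n : ℤ) : Module.End ℂ D.Fock :=
  ρ (D.mode (D.A α) n)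

variable (hρ : D.IsPrincipalRealization ρ)
include hρ

theorem map_mul_comm (x y : D.fixed) : ρ x * ρ y = ρ y * ρ x + ρ ⁅x, y⁆ := by
  rw [hρ.map_lie]
  abel

theorem dY_mul_rootOp (α : H.root) (p : D.Eplus) (n : ℤ) : D.dY p * rootOp ρ α n =
    rootOp ρ α n * D.dY p + rootFun α (D.e p.1) • rootOp ρ α (n + D.deg p) := by
  rw [← hρ.map_pos, rootOp, rootOp, ← map_smul, ← D.lie_heisenberg_mode_A (D.h_pos p)
    (D.t_pos_mem p), hρ.map_lie]
  abel

theorem mulY_mul_rootOp (α : H.root) (p : D.Eplus) (n : ℤ) : D.mulY p * rootOp ρ α n =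
    rootOp ρ α n * D.mulY p +
      (rootFun α (D.e (Fin.rev p.1)) / (D.deg p : ℂ)) • rootOp ρ α (n - D.deg p) := by
  have h0 : (D.deg p : ℂ) ≠ 0 := by exact_mod_cast (D.deg_pos p).ne'
  have h1 := hρ.map_lie (D.mode (D.e (Fin.rev p.1)) (-(D.deg p : ℤ))) (D.mode (D.A α) n)
  rw [D.lie_heisenberg_mode_A (D.h_pos p) (D.t_neg_mem p), hρ.map_neg, map_smul] at h1
  rw [div_eq_inv_mul, mul_smul, sub_eq_add_neg, rootOp, rootOp, h1, smul_sub, smul_mul_assoc,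
    mul_smul_comm, inv_smul_smul₀ h0, inv_smul_smul₀ h0]
  abel

theorem dElt_mul_rootOp (α : H.root) (n : ℤ) : ρ D.dElt * rootOp ρ α n =
    rootOp ρ α n * ρ D.dElt + (n : ℂ) • rootOp ρ α n := by
  rw [rootOp, ← map_smul, ← lie_dElt_mode, hρ.map_lie]
  abel

theorem dElt_mul_dY (p : D.Eplus) : ρ D.dElt * D.dY p =
    D.dY p * ρ D.dElt + (D.deg p : ℂ) • D.dY p := by
  have h1 := hρ.map_lie D.dElt (D.mode (D.e p.1) (D.deg p))
  rw [lie_dElt_mode, map_smul, hρ.map_pos, Int.cast_natCast] at h1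
  rw [h1]
  abel

theorem dElt_mul_mulY (p : D.Eplus) : ρ D.dElt * D.mulY p =
    D.mulY p * ρ D.dElt + (-(D.deg p : ℂ)) • D.mulY p := by
  have h0 : (D.deg p : ℂ) ≠ 0 := by exact_mod_cast (D.deg_pos p).ne'
  have h1 := map_mul_comm hρ D.dElt (D.mode (D.e (Fin.rev p.1)) (-(D.deg p : ℤ)))
  rw [lie_dElt_mode, map_smul, hρ.map_neg, mul_smul_comm, smul_mul_assoc,
    smul_comm _ (D.deg p : ℂ) (D.mulY p), ← smul_add] at h1
  have h2 := smul_right_injective _ h0 h1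
  rw [h2]
  push_cast; rfl

/-- The vacuum is an eigenvector of `d`. -/
theorem dElt_one : ρ D.dElt 1 = D.vac (ρ D.dElt 1) • (1 : D.Fock) := by
  have h1 (p : D.Eplus) : MvPolynomial.pderiv p (ρ D.dElt 1) = 0 := by
    have h2 := LinearMap.congr_fun (dElt_mul_dY hρ p) 1
    rw [LinearMap.add_apply, Module.End.mul_apply, Module.End.mul_apply, LinearMap.smul_apply,
      dY_one, map_zero, smul_zero, add_zero] at h2
    exact h2.symm
  ext m
  rw [MvPolynomial.coeff_smul, MvPolynomial.coeff_one]
  split_ifs with hm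
  · rw [← hm, vac_apply, smul_eq_mul, mul_one]; rfl
  · obtain ⟨p, hp⟩ := Finsupp.ne_iff.mp hm
    obtain ⟨m', rfl⟩ : ∃ m', m = m' + Finsupp.single p 1 :=
      ⟨m - Finsupp.single p 1, (tsub_add_cancel_of_le (by
        rw [Finsupp.single_le_iff]; exact Nat.one_le_iff_ne_zero.mpr (Ne.symm hp))).symm⟩
    have h3 := congrArg (MvPolynomial.coeff m') (h1 p)
    rw [MvPolynomial.coeff_pderiv, MvPolynomial.coeff_zero] at h3
    rw [smul_zero]
    exact (mul_eq_zero.mp h3).resolve_right (by exact_mod_cast (m' p).succ_ne_zero)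

theorem vac_dElt (v : D.Fock) : D.vac (ρ D.dElt v) = D.vac (ρ D.dElt 1) * D.vac v := by
  induction v using D.fock_induction with
  | h1 => simp
  | hadd u v hu hv => simp only [map_add, hu, hv, mul_add]
  | hsmul c v hv => simp only [map_smul, hv, smul_eq_mul, mul_left_comm]
  | hY p v hv =>
    have h2 := LinearMap.congr_fun (dElt_mul_mulY hρ p) v
    rw [LinearMap.add_apply, Module.End.mul_apply, Module.End.mul_apply, LinearMap.smul_apply] at h2
    rw [h2, map_add, map_smul, vac_mulY, vac_mulY, smul_zero, add_zero, mul_zero]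

/-- Up to an additive constant, `d` acts on the Fock space as minus the Euler operator
`∑ m y_m ∂_{y_m}`. -/
theorem dElt_apply (v : D.Fock) (S : Finset D.Eplus) (hS : v.vars ⊆ S) :
    ρ D.dElt v = D.vac (ρ D.dElt 1) • v - ∑ p ∈ S, (D.deg p : ℂ) • D.mulY p (D.dY p v) := by
  let E : Derivation ℂ D.Fock D.Fock :=
    MvPolynomial.mkDerivation ℂ fun p => (D.deg p : ℂ) • (MvPolynomial.X p : D.Fock)
  have hE (v : D.Fock) : ρ D.dElt v = D.vac (ρ D.dElt 1) • v - E v := by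
    induction v using D.fock_induction with
    | h1 => rw [Derivation.map_one_eq_zero, sub_zero]; exact dElt_one hρ
    | hadd u v hu hv => rw [map_add, map_add, hu, hv, smul_add]; abel
    | hsmul c v hv => rw [map_smul, Derivation.map_smul, hv, smul_sub, smul_comm]
    | hY p v hv =>
      have h2 := LinearMap.congr_fun (dElt_mul_mulY hρ p) v
      rw [LinearMap.add_apply, Module.End.mul_apply, Module.End.mul_apply, LinearMap.smul_apply,
        hv] at h2
      rw [h2, neg_smul]
      simp only [mulY_apply, Derivation.leibniz, E, MvPolynomial.mkDerivation_X, smul_eq_mul,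
        mul_sub, mul_smul_comm, mul_comm v, smul_mul_assoc]
      abel
  have hsum (w : D.Fock) : (∑ p ∈ S, ((D.deg p : ℂ) • (MvPolynomial.X p : D.Fock)) •
      (MvPolynomial.pderiv p : Derivation ℂ D.Fock D.Fock)) w =
      ∑ p ∈ S, (D.deg p : ℂ) • D.mulY p (D.dY p w) := by
    rw [← Derivation.coeFnAddMonoidHom_apply, map_sum, Finset.sum_apply]
    refine Finset.sum_congr rfl fun p _ => ?_
    rw [Derivation.coeFnAddMonoidHom_apply, Derivation.smul_apply, mulY_apply, dY_apply,
      smul_eq_mul, smul_mul_assoc]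
  rw [hE, ← hsum]
  refine congrArg _ (MvPolynomial.derivation_eq_of_forall_mem_vars fun q hq => ?_)
  rw [hsum, Finset.sum_eq_single q]
  · simp [E, MvPolynomial.mkDerivation_X, mulY_apply, dY_apply]
  · intro p _ hp
    rw [dY_apply, MvPolynomial.pderiv_X_of_ne (Ne.symm hp), map_zero, smul_zero]
  · exact fun h => absurd (hS hq) h

/-- Comparing the two sides of `[d, A_{α,n}] = n A_{α,n}` on the vacuum shows that only the mode
`n = 0` has a vacuum coefficient. -/
theorem vac_rootOp_one (α : H.root) {n : ℤ} (hn : n ≠ 0) : D.vac (rootOp ρ α n 1) = 0 := by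
  have h1 := congrArg D.vac (LinearMap.congr_fun (dElt_mul_rootOp hρ α n) 1)
  rw [LinearMap.add_apply, Module.End.mul_apply, Module.End.mul_apply, LinearMap.smul_apply,
    map_add, vac_dElt hρ, dElt_one hρ, map_smul, map_smul, map_smul] at h1
  have hn' : (n : ℂ) ≠ 0 := by exact_mod_cast hn
  simpa [hn'] using h1

/-- The root operators are the coefficients of a multiple of the vertex operator. -/
theorem rootOp_eq_smul_vertexOp (α : H.root) (n : ℤ) :
    rootOp ρ α n = D.vac (rootOp ρ α 0 1) • D.vertexOp (rootFun α) n := by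
  rw [← sub_eq_zero]
  refine D.eq_zero_of_commutators (fun p => rootFun α (D.e p.1))
    (fun p => rootFun α (D.e (Fin.rev p.1)) / (D.deg p : ℂ))
    (fun n => rootOp ρ α n - D.vac (rootOp ρ α 0 1) • D.vertexOp (rootFun α) n) ?_ ?_ ?_ n
  · intro p s
    rw [mul_sub, sub_mul, dY_mul_rootOp hρ, mul_smul_comm, dY_mul_vertexOp, smul_add, smul_sub,
      smul_mul_assoc, smul_comm (rootFun α (D.e p.1))]
    abel
  · intro p s
    rw [mul_sub, sub_mul, mulY_mul_rootOp hρ, mul_smul_comm, mulY_mul_vertexOp, smul_add, smul_sub,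
      smul_mul_assoc, smul_comm (rootFun α (D.e (Fin.rev p.1)) / (D.deg p : ℂ))]
    abel
  · intro s
    rw [LinearMap.sub_apply, LinearMap.smul_apply, map_sub, map_smul, vertexOp_apply, vertex_one,
      vac_crea, vac_one]
    by_cases hs : s = 0
    · subst hs; simp
    · rw [vac_rootOp_one hρ α hs, if_neg (by omega)]; simp

theorem rootOp_one_of_pos (α : H.root) {n : ℤ} (hn : 0 < n) : rootOp ρ α n 1 = 0 := by
  rw [rootOp_eq_smul_vertexOp hρ, LinearMap.smul_apply, vertexOp_apply, vertex_one,
    crea_of_neg _ _ (by omega), LinearMap.zero_apply, smul_zero]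

theorem rootOp_zero_one (α : H.root) :
    rootOp ρ α 0 1 = D.vac (rootOp ρ α 0 1) • (1 : D.Fock) := by
  conv_lhs => rw [rootOp_eq_smul_vertexOp hρ]
  rw [LinearMap.smul_apply, vertexOp_apply, vertex_one, neg_zero, crea_zero, Module.End.one_apply]

/-! ### Two-point functions -/

/-- The matrix coefficient `⟨A_{α,r} A_{β,-r}⟩` of the vacuum. -/
def twoPoint (ρ : D.fixed →ₗ[ℂ] Module.End ℂ D.Fock) (α β : H.root) (r : ℕ) : ℂ :=
  D.vac (rootOp ρ α r (rootOp ρ β (-r) 1))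

/-- The Euler identity for the homogeneous polynomial `A_{β,-r} 1`. -/
theorem smul_rootOp_neg_one (β : H.root) (r : ℕ) : (r : ℂ) • rootOp ρ β (-r) 1 =
    ∑ p ∈ D.degLE r, ((D.deg p : ℂ) * rootFun β (D.e p.1)) •
      D.mulY p (rootOp ρ β (-(r - D.deg p : ℕ)) 1) := by
  classical
  have hd (p : D.Eplus) : D.dY p (rootOp ρ β (-r) 1) =
      rootFun β (D.e p.1) • rootOp ρ β (-r + D.deg p) 1 := by
    have := LinearMap.congr_fun (dY_mul_rootOp hρ β p (-r)) 1
    rwa [LinearMap.add_apply, Module.End.mul_apply, Module.End.mul_apply, dY_one, map_zero,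
      zero_add] at this
  have h1 := LinearMap.congr_fun (dElt_mul_rootOp hρ β (-r)) 1
  rw [LinearMap.add_apply, Module.End.mul_apply, Module.End.mul_apply, dElt_one hρ, map_smul,
    dElt_apply hρ _ (D.degLE r ∪ (rootOp ρ β (-r) 1).vars) Finset.subset_union_right,
    LinearMap.smul_apply, sub_eq_add_neg, add_right_inj] at h1
  push_cast at h1
  rw [neg_smul, neg_inj] at h1
  rw [← h1, ← Finset.sum_subset Finset.subset_union_left]
  · refine Finset.sum_congr rfl fun p hp => ?_
    rw [hd, map_smul, smul_smul, Nat.cast_sub (mem_degLE.mp hp), neg_sub, neg_add_eq_sub]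
  · intro p _ hp
    rw [mem_degLE, not_le] at hp
    rw [hd, rootOp_one_of_pos hρ β (by omega), smul_zero, map_zero, smul_zero]

/-- Moving the operators `y_p` of the Euler identity to the left of `A_{α,r}`, where they do not
contribute to the vacuum coefficient, leaves the commutators. -/
theorem twoPoint_recursion (α : H.root) (r : ℕ) :
    (r : ℂ) * twoPoint ρ α (negRoot α) r = ∑ p ∈ D.degLE r,
      rootFun α (D.e p.1) * rootFun α (D.e (Fin.rev p.1)) *
        twoPoint ρ α (negRoot α) (r - D.deg p) := by
  rw [twoPoint, ← smul_eq_mul, ← map_smul, ← map_smul, smul_rootOp_neg_one hρ, map_sum, map_sum]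
  refine Finset.sum_congr rfl fun p hp => ?_
  have h0 : (D.deg p : ℂ) ≠ 0 := by exact_mod_cast (D.deg_pos p).ne'
  have h1 := congrArg D.vac (LinearMap.congr_fun (mulY_mul_rootOp hρ α p r)
    (rootOp ρ (negRoot α) (-(r - D.deg p : ℕ)) 1))
  rw [LinearMap.add_apply, Module.End.mul_apply, Module.End.mul_apply, LinearMap.smul_apply,
    map_add, map_smul, vac_mulY, smul_eq_mul, ← Nat.cast_sub (mem_degLE.mp hp)] at h1
  rw [map_smul, map_smul, rootFun_negRoot, LinearMap.neg_apply, smul_eq_mul, twoPoint]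
  field_simp at h1
  linear_combination (rootFun α (D.e p.1)) * h1

/-- The recursion for the two-point function in terms of the Fourier transform of
`k ↦ (α | Mᵏ α)`. -/
theorem twoPoint_succ (α : H.root) (r : ℕ) :
    ((r : ℂ) + 1) * twoPoint ρ α (negRoot α) (r + 1) =
      ∑ x ∈ Finset.HasAntidiagonal.antidiagonal r, twoPoint ρ α (negRoot α) x.1 *
        ∑ k ∈ Finset.Icc 1 D.h, D.dualForm (rootFun α) ((D.M ^ k) (rootFun α)) *
          (D.η ^ k) ^ (x.2 + 1) := by
  have hh := D.h_pos_of_root α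
  have h1 := twoPoint_recursion hρ α (r + 1)
  push_cast at h1
  rw [h1]
  simp only [D.sum_dualForm_mul_pow hh, Finset.mul_sum]
  rw [Finset.sum_comm, degLE, Finset.sum_filter, Finset.sum_product]
  refine Finset.sum_congr rfl fun i _ => ?_
  simp only [mul_ite, mul_zero]
  rw [← Finset.sum_filter, ← Finset.sum_filter]
  have hi := D.m_lt i
  change D.m i < D.h at hi
  have hpos := D.m_pos i
  -- a positive integer `m` congruent to `m_i` is `m_i + n h` with `n = m / h`
  refine Finset.sum_nbij' (fun n => (r + 1 - D.deg (i, n), D.deg (i, n) - 1))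
    (fun x => (x.2 + 1) / D.h) ?_ ?_ ?_ ?_ ?_
  · intro n hn
    simp only [Finset.mem_filter, Finset.mem_range] at hn
    have := D.deg_pos (i, n)
    simp only [Finset.mem_filter, Finset.HasAntidiagonal.mem_antidiagonal]
    refine ⟨by omega, ?_⟩
    rw [Nat.sub_add_cancel this, deg, Nat.add_mul_mod_self_right, Nat.mod_eq_of_lt hi]
  · rintro ⟨a, b⟩ hx
    simp only [Finset.mem_filter, Finset.HasAntidiagonal.mem_antidiagonal, Finset.mem_range] at hx ⊢
    have h2 : D.deg (i, (b + 1) / D.h) = b + 1 := by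
      rw [deg, ← hx.2]; exact Nat.mod_add_div' _ _
    have h3 := D.snd_le_deg (i, (b + 1) / D.h)
    dsimp only at h3
    rw [h2] at h3 ⊢
    omega
  · intro n hn
    dsimp only
    rw [Nat.sub_add_cancel (D.deg_pos (i, n)), deg, Nat.add_mul_div_right _ _ hh,
      Nat.div_eq_of_lt hi, zero_add]
  · rintro ⟨a, b⟩ hx
    simp only [Finset.mem_filter, Finset.HasAntidiagonal.mem_antidiagonal] at hx ⊢
    have h2 : D.deg (i, (b + 1) / D.h) = b + 1 := by
      rw [deg, ← hx.2]; exact Nat.mod_add_div' _ _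
    rw [h2, Prod.mk.injEq]
    omega
  · intro n hn
    ring

/-- The commutator of two root operators determines the two-point function. -/
theorem twoPoint_eq_sum (α β : H.root) {r : ℕ} (hr : 0 < r) :
    twoPoint ρ α β r = ∑ k ∈ Finset.Icc 1 D.h, ((D.η⁻¹) ^ k) ^ r *
      ((D.h : ℂ)⁻¹ * D.vac (ρ (D.mode ⁅((D.σ : g →ₗ[ℂ] g) ^ k) (D.A α), D.A β⁆ 0) 1) +
        r * ((D.h : ℂ)⁻¹ * (D.h : ℂ)⁻¹ *
          D.B.form (((D.σ : g →ₗ[ℂ] g) ^ k) (D.A α)) (D.A β))) := by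
  have hh := D.h_pos_of_root α
  have h1 := congrArg D.vac (LinearMap.congr_fun (hρ.map_lie (D.mode (D.A α) r)
    (D.mode (D.A β) (-r))) 1)
  have h2 : ρ (D.mode (D.A α) r) 1 = 0 := rootOp_one_of_pos hρ α (by exact_mod_cast hr)
  rw [D.lie_mode_neg hh, LinearMap.sub_apply, Module.End.mul_apply, Module.End.mul_apply, h2,
    map_zero, sub_zero, map_smul, map_sum, LinearMap.smul_apply, LinearMap.sum_apply, map_smul,
    map_sum, smul_eq_mul, Finset.mul_sum] at h1
  rw [twoPoint, rootOp, rootOp, ← h1]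
  refine Finset.sum_congr rfl fun k _ => ?_
  rw [map_smul, map_add, map_smul, hρ.map_K]
  simp only [LinearMap.smul_apply, LinearMap.add_apply, map_smul, map_add, Module.End.one_apply,
    vac_one, smul_eq_mul, mul_one, zpow_natCast, Int.cast_natCast, pow_right_comm]
  ring

/-- The product of the two constants `c_α` and `c_{-α}`, where `c_β` is the vacuum coefficient of
`A_{β,0} 1`. The index `k = h` of the comparison lemma carries the double pole at `1`. -/
theorem vac_mul_vac (α : H.root) :
    (D.h : ℂ) / D.B.form (D.A α) (D.A (negRoot α)) *
        (D.vac (rootOp ρ α 0 1) * D.vac (rootOp ρ (negRoot α) 0 1)) =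
      (D.h : ℂ)⁻¹ * ∏ k ∈ Finset.Icc 1 (D.h - 1),
        (1 - D.η ^ k) ^ (D.dualForm (rootFun α) ((D.M ^ k) (rootFun α))) := by
  have hh := D.h_pos_of_root α
  have hη := D.isPrimitiveRoot_η hh
  have hint (k : ℕ) : ∃ n : ℤ, D.dualForm (rootFun α) ((D.M ^ k) (rootFun α)) = n := by
    obtain ⟨β, hβ, -⟩ := D.σ_pow_A k α
    rw [← hβ]
    exact D.exists_int_dualForm α β
  choose n hn using hint
  have hins : insert D.h (Finset.Icc 1 (D.h - 1)) = Finset.Icc 1 D.h := by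
    ext k; simp only [Finset.mem_insert, Finset.mem_Icc]; omega
  have hne (k : ℕ) (hk : k ∈ Finset.Icc 1 (D.h - 1)) : D.η ^ k ≠ 1 := by
    rw [Finset.mem_Icc] at hk
    exact hη.pow_ne_one_of_pos_of_lt (by omega) (by omega)
  have h2 : n D.h = 2 := by
    have h3 := hn D.h
    rw [show D.M ^ D.h = 1 from pow_orderOf_eq_one D.M, LinearEquiv.coe_one, id_eq,
      dualForm_root_self] at h3
    exact_mod_cast h3.symm
  have key := double_pole_comparison (Finset.Icc 1 (D.h - 1)) D.h (by simp; omega)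
    (fun k => D.η ^ k) (fun k => D.η⁻¹ ^ k) n
    (fun k => (D.h : ℂ)⁻¹ *
      D.vac (ρ (D.mode ⁅((D.σ : g →ₗ[ℂ] g) ^ k) (D.A α), D.A (negRoot α)⁆ 0) 1))
    (fun k => (D.h : ℂ)⁻¹ * (D.h : ℂ)⁻¹ *
      D.B.form (((D.σ : g →ₗ[ℂ] g) ^ k) (D.A α)) (D.A (negRoot α)))
    (twoPoint ρ α (negRoot α)) D.η_pow_h (by rw [inv_pow, D.η_pow_h, inv_one]) hne
    (fun k hk => by rw [inv_pow, inv_ne_one]; exact hne k hk) h2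
    (fun r => by rw [twoPoint_succ hρ]; simp only [hn, hins])
    (fun r hr => by rw [twoPoint_eq_sum hρ _ _ hr, hins])
  have h3 : twoPoint ρ α (negRoot α) 0 =
      D.vac (rootOp ρ α 0 1) * D.vac (rootOp ρ (negRoot α) 0 1) := by
    rw [twoPoint, Nat.cast_zero, neg_zero, rootOp_zero_one hρ (negRoot α), map_smul, map_smul,
      map_smul, vac_one, smul_eq_mul, smul_eq_mul, mul_one, mul_comm]
  rw [h3] at key
  have hB := D.form_A_negRoot_ne_zero α
  have h0 := D.cast_h_ne_zero hh
  simp only [hn, Complex.cpow_intCast]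
  rw [key, D.σ_pow_h]
  field_simp

end Realization

end PrincipalData

end KacWakimoto

end

theorem mainTheorem4 {g : Type*} [LieRing g] [LieAlgebra ℂ g] [FiniteDimensional ℂ g]
    [LieAlgebra.IsSimple ℂ g] (H : LieSubalgebra ℂ g) [H.IsCartanSubalgebra]
    (D : KacWakimoto.PrincipalData H)
    (ρ : D.fixed →ₗ[ℂ] Module.End ℂ D.Fock) (hρ : D.IsPrincipalRealization ρ)
    (α : H.root) (a : ℂ) :
    D.IsKWCoefficient ρ α a ↔
      a = (D.h : ℂ)⁻¹ * ∏ k ∈ Finset.Icc 1 (D.h - 1),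
        (1 - D.η ^ k) ^ (D.dualForm (KacWakimoto.rootFun α)
          ((D.M ^ k) (KacWakimoto.rootFun α))) := by
  open KacWakimoto KacWakimoto.PrincipalData in
  have hcur (β : H.root) : D.current ρ β =
      fun n w => D.vac (rootOp ρ β 0 1) • D.vertex (rootFun β) n w := by
    funext n w
    exact LinearMap.congr_fun (rootOp_eq_smul_vertexOp hρ β n) w
  rw [← vac_mul_vac hρ α]
  unfold IsKWCoefficient
  simp only [hcur, tensorCoeff_smul, rootFun_negRoot, smul_smul]
  constructor
  · intro h
    exact (smul_left_injective ℂ (D.tensorCoeff_vertex_ne_zero _ _) (h 0 1 1)).symm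
  · rintro rfl s u v
    rfl
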